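/- Terms are untyped $\lambda$-terms; $\triangleright^*$ is $\beta$-reduction in any number of steps, a term is solvable if it has a head normal form, and $\Omega=(\lambda x.\,x\,x)(\lambda x.\,x\,x)$. Write $u\simeq v$ if $u$ and $v$ have a common reduct for the union of $\beta$-reduction and the $\Omega$-reduction that replaces an unsolvable subterm by $\Omega$, and $[t]_{\mathcal H}$ for the class of $t$ modulo $\simeq$. For a closed term $\lambda x.F$ the range of $\lambda x.F$ in $\mathcal H$ is $\{[F[x:=u]]_{\mathcal H} : u \text{ a closed term}\}$. Write $t[B]$ for $t[x:=B]$, and $c_n$ for the $n$-th Church numeral. **Data.** Let $\lambda x.F$ and $A$ be closed terms with $F[A]\not\simeq F[\Omega]$. Let $(F_k)_{k\in\mathbb N}$ be terms with $F_0=F$, $F_k\triangleright^*F_{k+1}$ for all $k$, and such that every $\beta$-reduct of $F$ reduces to some $F_k$. For an occurrence of $x$ in a term let its list of arguments be the maximal list $U$ such that the occurrence is the head of a subterm $(x\,U)$. An occurrence of $x$ in $t$ is *pure* if it does not lie in an argument of another occurrence of $x$; it is *good* if it is pure and $u[A]$ is solvable for every subterm $u$ of $t$ that contains it. For each $k$ let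 $x_{(k)}$ be a good occurrence of $x$ in $F_k$ such that $x_{(k+1)}$ is a residue of $x_{(k)}$ along a reduction $F_k\triangleright^*F_{k+1}$ (an infinite good branch), and let $U_k$ be the list of arguments of $x_{(k)}$ in $F_k$. Let $A'$ be a term with a free variable $\nu$ obtained in one of the following two ways. 1. There are $l,q,p\in\mathbb N$ such that every $U_k$ has length at most $l$, for all large $k$ the head normal form of $(A\,U_k[A])$ begins with exactly $q$ abstractions, and $p\ge q+l+2$; and $A'=(J\,\nu\,A)$ with $J=Y\,(\lambda k\lambda n\lambda u\lambda y_1\dots\lambda y_p.\,u\,(k\,n\,y_1)\cdots(k\,n\,y_p))$, where $Y$ is the Turing fixed point operator. 2. $A'=(\widehat J\,c_0\,\nu\,A)$ with $\widehat J=Y\,(\lambda z\lambda k\lambda n\lambda x.\,H\,k\,T\,I\,x)$, $I=\lambda x.\,x$, $T=\lambda a\lambda b\lambda c.\,a\,(b\,(z\,(suc\,k)\,n\,c))$, $suc=\lambda n\lambda f\lambda x.\,f\,(n\,f\,x)$, where $H$ is a closed term that represents a function $h:\mathbb N\to\mathbb N$, that is, $H\,c_n\triangleright^*c_{h(n)}$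 for all $n$, and $h$ satisfies the following. Let $\gamma$ be a fresh variable and, for a term $G$, let $E_i(G)=\lambda n\lambda x\lambda x_1\dots\lambda x_{h(i)}.\,x\,(G\,n\,x_1)\cdots(G\,n\,x_{h(i)})$; put $\tilde J_0=E_0(\gamma)$ and $\tilde J_{n+1}=\tilde J_n[\gamma:=E_{n+1}(\gamma)]$. There are integers $j_0<j_1<j_2<\cdots$ such that for each $n$ there are a sequence $X$ of variables, a term $a$ and a list $B$ of terms with $(\tilde J_n\,\nu\,A\;U_{j_n}[A])\triangleright^*\lambda X.\,(\gamma\,\nu\,a\,B)$ and $h(n+1)\ge l_n+\mathrm{length}(B)+1$, where $l_n$ is the number of abstractions at the head of the head normal form of $(A\,U_{j_n}[A])$. Put $A_n=A'[\nu:=c_n]$. **Proposition.** Assume that $F$, $A$ satisfy the *Scope lemma*: for all $n,m$, if $F[A_n]\simeq F[A_m]$, then $(x\,U_k)[A_n]\simeq(x\,U_k)[A_m]$ for some $k$. Then the range of $\lambda x.F$ in $\mathcal H$ is infinite. -/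

import Mathlib

namespace RangeH

/-- Untyped lambda terms up to alpha-equivalence, in de Bruijn notation: under `d` binders the
index `i < d` is a bound variable and the index `d + i` is the free variable number `i`. -/
inductive Tm : Type
  | var : ℕ → Tm
  | app : Tm → Tm → Tm
  | lam : Tm → Tm

open Tm

/-- Extend a renaming under one binder. -/
def liftRen (r : ℕ → ℕ) : ℕ → ℕ
  | 0 => 0
  | n + 1 => r n + 1

/-- Extend a renaming under `d` binders. -/
def liftRenN : ℕ → (ℕ → ℕ) → ℕ → ℕ
  | 0, r => r
  | d + 1, r => liftRen (liftRenN d r)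

def Tm.rename : (ℕ → ℕ) → Tm → Tm
  | r, var n => var (r n)
  | r, app s t => app (s.rename r) (t.rename r)
  | r, lam t => lam (t.rename (liftRen r))

/-- Extend a substitution under one binder. -/
def liftSub (s : ℕ → Tm) : ℕ → Tm
  | 0 => var 0
  | n + 1 => (s n).rename Nat.succ

/-- Simultaneous capture-avoiding substitution. -/
def Tm.subst : (ℕ → Tm) → Tm → Tm
  | s, var n => s n
  | s, app t u => app (t.subst s) (u.subst s)
  | s, lam t => lam (t.subst (liftSub s))

/-- The contractum of the redex `(lam t) u`. -/
def Tm.contract (t u : Tm) : Tm :=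
  t.subst (fun i => match i with
    | 0 => u
    | n + 1 => var n)

/-- Replace the free variable `d` by `u` and leave the other variables alone. -/
def Tm.replace (t : Tm) (d : ℕ) (u : Tm) : Tm :=
  t.subst (fun i => if i = d then u else var i)

/-- All free variables of the term have an index below the given bound. -/
def Tm.FreeBelow : ℕ → Tm → Prop
  | d, var n => n < d
  | d, app s t => s.FreeBelow d ∧ t.FreeBelow d
  | d, lam t => t.FreeBelow (d + 1)

def Tm.Closed (t : Tm) : Prop := t.FreeBelow 0

/-- `apps t [u₁, …, uₙ]` is `(t u₁ … uₙ)`. -/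
def apps (t : Tm) (us : List Tm) : Tm := us.foldl app t

/-- `lams n t` is `t` under `n` abstractions. -/
def lams : ℕ → Tm → Tm
  | 0, t => t
  | n + 1, t => lam (lams n t)

/-! ### Reduction and equality in the theory -/

/-- One step of beta-reduction, at any place. -/
inductive Beta : Tm → Tm → Prop
  | red (t u : Tm) : Beta (app (lam t) u) (t.contract u)
  | appL {s s' : Tm} (t : Tm) : Beta s s' → Beta (app s t) (app s' t)
  | appR (s : Tm) {t t' : Tm} : Beta t t' → Beta (app s t) (app s t')
  | lam {t t' : Tm} : Beta t t' → Beta (lam t) (lam t')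

/-- Beta-reduction in any number of steps. -/
def BetaStar : Tm → Tm → Prop := Relation.ReflTransGen Beta

/-- `t` has a head normal form that begins with exactly `l` abstractions (`l` is determined by
`t`, by the Church-Rosser property). -/
def HasHnf (t : Tm) (l : ℕ) : Prop :=
  ∃ (y : ℕ) (w : List Tm), BetaStar t (lams l (apps (var y) w))

/-- Solvable terms: those with a head normal form. -/
def Solvable (t : Tm) : Prop := ∃ l, HasHnf t l

/-- The term `Ω = (λx. x x) (λx. x x)`. -/
def omega : Tm := app (lam (app (var 0) (var 0))) (lam (app (var 0) (var 0)))

/-- One step of Omega-reduction, at any place: an unsolvable subterm is replaced by `Ω`. -/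
inductive OmegaStep : Tm → Tm → Prop
  | red (t : Tm) : ¬ Solvable t → OmegaStep t omega
  | appL {s s' : Tm} (t : Tm) : OmegaStep s s' → OmegaStep (app s t) (app s' t)
  | appR (s : Tm) {t t' : Tm} : OmegaStep t t' → OmegaStep (app s t) (app s t')
  | lam {t t' : Tm} : OmegaStep t t' → OmegaStep (lam t) (lam t')

def BetaOmegaStar : Tm → Tm → Prop :=
  Relation.ReflTransGen (fun t u => Beta t u ∨ OmegaStep t u)

/-- Equality in the theory `H`: a common beta-Omega-reduct. -/
def EqH (u v : Tm) : Prop := ∃ w, BetaOmegaStar u w ∧ BetaOmegaStar v w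

/-- The class of a term modulo equality in `H`. -/
def classH (t : Tm) : Set Tm := {v | EqH t v}

/-- The range of `λx.F` in `H`; here `x` is the free variable `0` of `F`. -/
def rangeH (F : Tm) : Set (Set Tm) :=
  {c | ∃ u : Tm, u.Closed ∧ c = classH (F.replace 0 u)}

/-! ### Occurrences of `x`

An occurrence of `x` in a term is given by the one-hole context that surrounds it. -/

/-- One layer of a context. -/
inductive Frame : Type
  /-- the hole is the body of an abstraction -/
  | lam : Frame
  /-- the hole is in function position, with the given argument -/
  | fn : Tm → Frame
  /-- the hole is in argument position, with the given function -/
  | arg : Tm → Frame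

/-- One-hole contexts, as lists of layers with the innermost layer first. -/
abbrev Ctx : Type := List Frame

def Frame.plug : Frame → Tm → Tm
  | .lam, t => Tm.lam t
  | .fn u, t => app t u
  | .arg f, t => app f t

/-- Put a term into the hole (variables may be captured). -/
def Ctx.fill : Ctx → Tm → Tm
  | [], t => t
  | f :: C, t => Ctx.fill C (f.plug t)

/-- The number of binders above the hole. -/
def Ctx.depth : Ctx → ℕ
  | [] => 0
  | .lam :: C => Ctx.depth C + 1
  | .fn _ :: C => Ctx.depth C
  | .arg _ :: C => Ctx.depth C

def Frame.rename (r : ℕ → ℕ) : Frame → Frame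
  | .lam => .lam
  | .fn u => .fn (u.rename r)
  | .arg f => .arg (f.rename r)

/-- Rename the free variables of a context. -/
def Ctx.rename (r : ℕ → ℕ) : Ctx → Ctx
  | [] => []
  | f :: C => f.rename (liftRenN (Ctx.depth C) r) :: Ctx.rename r C

/-- The maximal list of arguments `U` of the term in the hole. For an occurrence of `x` the
subterm `(x U)` is `apps (var C.depth) C.args`; it may contain the variables `0, …, C.depth - 1`,
which are bound further out, and `x`, which has the index `C.depth` there. -/
def Ctx.args : Ctx → List Tm
  | .fn u :: C => u :: Ctx.args C
  | _ => []

/-- The list `U[A]`, where `U` is the list of arguments at the hole. -/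
def Ctx.argsAt (C : Ctx) (A : Tm) : List Tm := (Ctx.args C).map fun u => u.replace (Ctx.depth C) A

/-- `C` is an occurrence of the free variable `x` (number `0`) in `t`. -/
def IsOcc (C : Ctx) (t : Tm) : Prop := t = Ctx.fill C (var (Ctx.depth C))

/-- The occurrence is pure: it is not inside an argument of another occurrence of `x`. -/
def Pure (C : Ctx) : Prop :=
  ∀ (C₁ C₂ : Ctx) (f : Tm), C = C₁ ++ Frame.arg f :: C₂ →
    ¬ ∃ L : List Tm, f = apps (var (Ctx.depth C₂)) L

/-- The occurrence is good: it is pure, and `u[A]` is solvable for every subterm `u` that contains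
the occurrence. -/
def Good (A : Tm) (C : Ctx) : Prop :=
  Pure C ∧ ∀ C₁ C₂ : Ctx, C = C₁ ++ C₂ →
    Solvable ((Ctx.fill C₁ (var (Ctx.depth C))).replace (Ctx.depth C₂) A)

/-- Identify the free variable `1` with the free variable `0`. -/
def unmark (i : ℕ) : ℕ := if i = 1 then 0 else i

/-- The occurrence `C'` of `x` is a residue of the occurrence `C` of `x` along some
beta-reduction: mark the occurrence `C` by writing a fresh variable (number `1`) there, perform the
reduction, and look at a marked place of the result. (The terms concerned have no free variable
other than number `0`.) -/
def IsResidue (C C' : Ctx) : Prop :=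
  ∃ C'' : Ctx, BetaStar (Ctx.fill C (var (Ctx.depth C + 1))) (Ctx.fill C'' (var (Ctx.depth C'' + 1)))
    ∧ Ctx.rename unmark C'' = C'

/-- A cofinal sequence of reducts of `F`. -/
structure IsCofinal (F : Tm) (Fs : ℕ → Tm) : Prop where
  zero : Fs 0 = F
  step : ∀ k, BetaStar (Fs k) (Fs (k + 1))
  cofinal : ∀ G, BetaStar F G → ∃ k, BetaStar G (Fs k)

/-- An infinite good branch in the tree of the pure occurrences of `x` in the terms `Fs k`. -/
structure IsGoodBranch (A : Tm) (Fs : ℕ → Tm) (C : ℕ → Ctx) : Prop where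
  occ : ∀ k, IsOcc (C k) (Fs k)
  good : ∀ k, Good A (C k)
  residue : ∀ k, IsResidue (C k) (C (k + 1))

/-! ### The terms `A'` -/

/-- The Church numeral `λf.λx. f (… (f x))`. -/
def church (n : ℕ) : Tm := lam (lam ((app (var 1))^[n] (var 0)))

/-- The successor `λn.λf.λx. f (n f x)`. -/
def suc : Tm := lam (lam (lam (app (var 1) (app (app (var 2) (var 1)) (var 0)))))

def ident : Tm := lam (var 0)

/-- The fixed point operator of Turing: `(λx.λy. y (x x y)) (λx.λy. y (x x y))`. -/
def turing : Tm :=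
  app (lam (lam (app (var 0) (app (app (var 1) (var 1)) (var 0)))))
    (lam (lam (app (var 0) (app (app (var 1) (var 1)) (var 0)))))

/-- The term `λn.λu.λy₁…λyₕ. u (G n y₁) … (G n yₕ)`. -/
def expand (h : ℕ) (G : Tm) : Tm :=
  lams (h + 2) (apps (var h)
    ((List.range h).map fun i =>
      app (app (G.rename (· + (h + 2))) (var (h + 1))) (var (h - 1 - i))))

/-- A term `J` with `(J n u) ▷* λy₁…λyₚ. u (J n y₁) … (J n yₚ)`. -/
def constJ (p : ℕ) : Tm := app turing (lam (expand p (var 0)))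

/-- `Y (λz.λk.λn.λx. H k T I x)` with `T = λa.λb.λc. a (b (z (suc k) n c))`. If `H` represents the
function `h` and `Jᵢ` is `(varJ H cᵢ)`, then `(Jᵢ n u)` and
`λy₁…λyₛ. u (Jᵢ₊₁ n y₁) … (Jᵢ₊₁ n yₛ)`, where `s = h i`, are beta-equal. -/
def varJ (H : Tm) : Tm :=
  app turing (lam (lam (lam (lam
    (apps H
      [var 2,
        lam (lam (lam (app (var 2)
          (app (var 1) (apps (var 6) [app suc (var 5), var 4, var 0]))))),
        ident, var 0])))))

/-- The finite approximation of the preceding term for the values `h 0, …, h n`, in which a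
constant `g` stands for all that comes later. -/
def approxJ (h : ℕ → ℕ) : ℕ → Tm → Tm
  | 0, g => expand (h 0) g
  | n + 1, g => approxJ h n (expand (h (n + 1)) g)

/-- `A' = (J ν A)` with `J` of constant arity `p`, for the case where the lengths of the `Uₖ` are
bounded by `l` and the head normal forms of `(A Uₖ[A])` finally have a constant number `q` of
abstractions; `ν` is the free variable `0` of `A'`. -/
def FirstConstruction (A : Tm) (C : ℕ → Ctx) (A' : Tm) : Prop :=
  ∃ l q p : ℕ,
    (∀ k, (Ctx.args (C k)).length ≤ l) ∧
    (∃ k₀, ∀ k ≥ k₀, HasHnf (apps A (Ctx.argsAt (C k) A)) q) ∧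
    q + l + 2 ≤ p ∧
    A' = apps (constJ p) [var 0, A]

/-- `A' = (J₀ ν A)`, where `Jᵢ` has the arity `h i`. The values of `h` are chosen along a sequence
`j 0 < j 1 < …` of levels of the branch. At the level `j n`, with the variables of index below `d`
already in use, the constant `γ` (index `d + 1`) of the `n`-th approximation, which stands for
`Jₙ₊₁`, comes in head position in front of `ν` (index `d`), of a term `a` and of a list `B`
of arguments; then `h (n + 1)` exceeds the length of `B` by more than the number `l` of
abstractions of the head normal form of `(A U[A])` at that level. -/
def SecondConstruction (A : Tm) (C : ℕ → Ctx) (A' : Tm) : Prop :=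
  ∃ (h j : ℕ → ℕ) (H : Tm),
    H.Closed ∧ (∀ n, BetaStar (app H (church n)) (church (h n))) ∧
    StrictMono j ∧
    (∀ n, ∃ (d l m : ℕ) (a : Tm) (B : List Tm),
      d = Ctx.depth (C (j n)) ∧
      HasHnf (apps A (Ctx.argsAt (C (j n)) A)) l ∧
      BetaStar
        (apps (approxJ h n (var (d + 1))) (var d :: A :: Ctx.argsAt (C (j n)) A))
        (lams m (apps (var (d + 1 + m)) (var (d + m) :: a :: B))) ∧
      l + B.length + 1 ≤ h (n + 1)) ∧
    A' = apps (varJ H) [church 0, var 0, A]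

/-- The term `Aₙ = A'[ν := cₙ]`. -/
def numeralInstance (A' : Tm) (n : ℕ) : Tm := A'.replace 0 (church n)

/-- The scope lemma, for the branch `C` and the term `A'`: if `F[Aₙ]` and `F[Aₘ]` are equal in `H`
then `(x Uₖ)[Aₙ]` and `(x Uₖ)[Aₘ]` are equal in `H` for some `k`. -/
def ScopeLemma (F : Tm) (C : ℕ → Ctx) (A' : Tm) : Prop :=
  ∀ n m : ℕ,
    EqH (F.replace 0 (numeralInstance A' n)) (F.replace 0 (numeralInstance A' m)) →
    ∃ k : ℕ,
      EqH
        ((apps (var (Ctx.depth (C k))) (Ctx.args (C k))).replace (Ctx.depth (C k))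
          (numeralInstance A' n))
        ((apps (var (Ctx.depth (C k))) (Ctx.args (C k))).replace (Ctx.depth (C k))
          (numeralInstance A' m))

end RangeH

/-!
# Infinite range of `λx.F` in the theory `H`

The terms `Aₙ` have the form `(Kₙ A)`, where `Kₙ` is a *wrapper*: it carries the numeral `cₙ`, and
`(Kₙ r)` unfolds to `λy₁…λyₕ. r (K'ₙ y₁) … (K'ₙ yₕ)` with further wrappers `K'ₙ` for the same
numeral. A numeral inside wrappers cannot get lost. If the arity of a wrapper exceeds the number of
arguments after the wrapped term and the number of abstractions in the head normal form of the
wrapped term with these arguments together, then the last argument of the head normal form of the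
whole is a *nest*, one or more wrappers around a variable (`Near.lastNest`). A nest again has a nest
as the last argument of its head normal form. Parallel reduction with replacement of unsolvable
subterms by `Ω` keeps all this (`NestAt.pars`), except that a fixed point operator may be unrolled
once, after which the next nest further inside is intact. Hence two terms that are equal in `H` and
have nests as last arguments carry the same numeral (`LastNest.eq_of_eqH`). Confluence is not
needed: head reduction is deterministic, and by standardization (`BetaStar.st`) a term with a head
normal form comes to one by head reduction.

By the scope lemma it remains to see that `(x Uₖ)[Aₙ]` has a nest for `cₙ` as its last argument,
after a substitution and with further arguments, which both keep equality
(`range_infinite_of_lastNest`). The arguments of the occurrence at a later level of the branch come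
from `Uₖ` by substitution, reduction and addition of arguments (`IsGoodBranch.args_later`). For
wrappers of constant arity, this bounds the number of abstractions of `(A Uₖ[A])`. For wrappers of
variable arity, one passes from the level `k` to the level `j k ≥ k`; there the finite
approximation, whose constant comes into head position, is run in parallel with the term itself (`Sim.lastNest`),
so that a wrapper of index `k + 1` comes into head position, and its arity is large enough.
-/

namespace RangeH

open Tm

/-! ### Renaming and substitution -/

theorem liftRen_comp (r r' : ℕ → ℕ) :
    (fun i => liftRen r' (liftRen r i)) = liftRen (fun i => r' (r i)) := by
  funext i; cases i <;> rfl

theorem rename_rename (t : Tm) (r r' : ℕ → ℕ) :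
    (t.rename r).rename r' = t.rename (fun i => r' (r i)) := by
  induction t generalizing r r' with
  | var n => rfl
  | app s t hs ht => simp [Tm.rename, hs, ht]
  | lam t ht => simp [Tm.rename, ht, liftRen_comp]

theorem subst_rename (t : Tm) (r : ℕ → ℕ) (s : ℕ → Tm) :
    (t.rename r).subst s = t.subst (fun i => s (r i)) := by
  induction t generalizing r s with
  | var n => rfl
  | app u t hu ht => simp [Tm.rename, Tm.subst, hu, ht]
  | lam t ht =>
    have : (fun i => liftSub s (liftRen r i)) = liftSub (fun i => s (r i)) := by
      funext i; cases i <;> rfl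
    simp [Tm.rename, Tm.subst, ht, this]

theorem rename_subst (t : Tm) (s : ℕ → Tm) (r : ℕ → ℕ) :
    (t.subst s).rename r = t.subst (fun i => (s i).rename r) := by
  induction t generalizing r s with
  | var n => rfl
  | app u t hu ht => simp [Tm.rename, Tm.subst, hu, ht]
  | lam t ht =>
    have : (fun i => (liftSub s i).rename (liftRen r)) = liftSub (fun i => (s i).rename r) := by
      funext i
      cases i with
      | zero => rfl
      | succ i => simp [liftSub, rename_rename, liftRen]
    simp [Tm.rename, Tm.subst, ht, this]

theorem subst_subst (t : Tm) (s s' : ℕ → Tm) :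
    (t.subst s).subst s' = t.subst (fun i => (s i).subst s') := by
  induction t generalizing s s' with
  | var n => rfl
  | app u t hu ht => simp [Tm.subst, hu, ht]
  | lam t ht =>
    have : (fun i => (liftSub s i).subst (liftSub s')) = liftSub (fun i => (s i).subst s') := by
      funext i
      cases i with
      | zero => rfl
      | succ i => simp [liftSub, subst_rename, rename_subst]
    simp [Tm.subst, ht, this]

theorem liftSub_var : liftSub var = var := by
  funext i; cases i <;> rfl

theorem subst_var (t : Tm) : t.subst var = t := by
  induction t with
  | var n => rfl
  | app u t hu ht => simp [Tm.subst, hu, ht]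
  | lam t ht => simp [Tm.subst, liftSub_var, ht]

theorem rename_eq_subst (t : Tm) (r : ℕ → ℕ) : t.rename r = t.subst (fun i => var (r i)) := by
  have := subst_rename t r var
  rwa [subst_var] at this

/-- Extend a substitution by a value for the variable `0`. -/
def scons (u : Tm) (s : ℕ → Tm) : ℕ → Tm
  | 0 => u
  | n + 1 => s n

theorem contract_eq (t u : Tm) : t.contract u = t.subst (scons u var) := by
  unfold Tm.contract
  congr 1

theorem liftSub_contract (t u : Tm) (s : ℕ → Tm) :
    (t.subst (liftSub s)).contract u = t.subst (scons u s) := by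
  rw [contract_eq, subst_subst]
  congr 1
  funext i
  cases i with
  | zero => rfl
  | succ i => exact (subst_rename _ _ _).trans (subst_var _)

theorem contract_subst (t u : Tm) (s : ℕ → Tm) :
    (t.contract u).subst s = (t.subst (liftSub s)).contract (u.subst s) := by
  rw [liftSub_contract, contract_eq, subst_subst]
  congr 1
  funext i; cases i <;> rfl

theorem liftRen_eq_liftSub (r : ℕ → ℕ) :
    (fun i => var (liftRen r i)) = liftSub (fun i => var (r i)) := by
  funext i; cases i <;> rfl

theorem contract_rename (t u : Tm) (r : ℕ → ℕ) :
    (t.contract u).rename r = (t.rename (liftRen r)).contract (u.rename r) := by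
  rw [rename_eq_subst, contract_subst, rename_eq_subst t, rename_eq_subst u, liftRen_eq_liftSub]

/-- Renaming the body of an abstraction away from its variable and feeding that variable back
gives the body. -/
theorem liftRen_succ_contract_var (t : Tm) :
    (t.rename (liftRen Nat.succ)).contract (var 0) = t := by
  rw [contract_eq, subst_rename]
  conv_rhs => rw [← subst_var t]
  congr 1
  funext i; cases i <;> rfl

theorem rename_id (t : Tm) : t.rename (fun i => i) = t := by
  rw [rename_eq_subst]; exact subst_var t

theorem contract_var_eq_rename (t : Tm) (y : ℕ) :
    t.contract (var y) = t.rename (fun i => i.casesOn y id) := by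
  rw [contract_eq, rename_eq_subst]
  congr 1
  funext i; cases i <;> rfl

/-! ### Free variables -/

theorem subst_congr_of_freeBelow {t : Tm} {d : ℕ} (h : t.FreeBelow d) {s s' : ℕ → Tm}
    (hs : ∀ i < d, s i = s' i) : t.subst s = t.subst s' := by
  induction t generalizing d s s' with
  | var n => exact hs n h
  | app u t hu ht => simp only [Tm.subst, hu h.1 hs, ht h.2 hs]
  | lam t ht =>
    simp only [Tm.subst]
    refine congrArg _ (ht (d := d + 1) h fun i hi => ?_)
    cases i with
    | zero => rfl
    | succ i => simp [liftSub, hs i (by omega)]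

theorem subst_of_freeBelow {t : Tm} {d : ℕ} (h : t.FreeBelow d) {s : ℕ → Tm}
    (hs : ∀ i < d, s i = var i) : t.subst s = t :=
  (subst_congr_of_freeBelow h hs).trans (subst_var t)

theorem Tm.Closed.subst {t : Tm} (h : t.Closed) (s : ℕ → Tm) : t.subst s = t :=
  subst_of_freeBelow h fun i hi => absurd hi (Nat.not_lt_zero i)

theorem Tm.Closed.rename {t : Tm} (h : t.Closed) (r : ℕ → ℕ) : t.rename r = t := by
  rw [rename_eq_subst, h.subst]

theorem Tm.FreeBelow.mono {t : Tm} {d e : ℕ} (h : t.FreeBelow d) (hde : d ≤ e) :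
    t.FreeBelow e := by
  induction t generalizing d e with
  | var n => exact lt_of_lt_of_le (show n < d from h) hde
  | app u t hu ht => exact ⟨hu h.1 hde, ht h.2 hde⟩
  | lam t ht => exact ht (d := d + 1) h (by omega)

theorem Tm.Closed.freeBelow {t : Tm} (h : t.Closed) (d : ℕ) : t.FreeBelow d :=
  Tm.FreeBelow.mono h (Nat.zero_le d)

theorem exists_freeBelow (t : Tm) : ∃ d, t.FreeBelow d := by
  induction t with
  | var n => exact ⟨n + 1, Nat.lt_succ_self n⟩
  | app u t hu ht =>
    obtain ⟨a, ha⟩ := hu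
    obtain ⟨b, hb⟩ := ht
    exact ⟨max a b, ha.mono (le_max_left _ _), hb.mono (le_max_right _ _)⟩
  | lam t ht =>
    obtain ⟨a, ha⟩ := ht
    exact ⟨a, ha.mono (Nat.le_succ a)⟩

theorem exists_freeBelow_list (L : List Tm) : ∃ d, ∀ t ∈ L, t.FreeBelow d := by
  induction L with
  | nil => exact ⟨0, by simp⟩
  | cons t L ih =>
    obtain ⟨a, ha⟩ := exists_freeBelow t
    obtain ⟨b, hb⟩ := ih
    refine ⟨max a b, fun u hu => ?_⟩
    rcases List.mem_cons.1 hu with rfl | hu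
    · exact ha.mono (le_max_left _ _)
    · exact (hb u hu).mono (le_max_right _ _)

theorem Tm.FreeBelow.rename {t : Tm} {d e : ℕ} (h : t.FreeBelow d) {r : ℕ → ℕ}
    (hr : ∀ i < d, r i < e) : (t.rename r).FreeBelow e := by
  induction t generalizing d e r with
  | var n => exact hr n h
  | app u t hu ht => exact ⟨hu h.1 hr, ht h.2 hr⟩
  | lam t ht =>
    refine ht (d := d + 1) (e := e + 1) h fun i hi => ?_
    cases i with
    | zero => simp [liftRen]
    | succ i => simpa [liftRen] using hr i (by omega)

theorem Tm.FreeBelow.subst {t : Tm} {d e : ℕ} (h : t.FreeBelow d) {s : ℕ → Tm}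
    (hs : ∀ i < d, (s i).FreeBelow e) : (t.subst s).FreeBelow e := by
  induction t generalizing d e s with
  | var n => exact hs n h
  | app u t hu ht => exact ⟨hu h.1 hs, ht h.2 hs⟩
  | lam t ht =>
    refine ht (d := d + 1) (e := e + 1) h fun i hi => ?_
    cases i with
    | zero => exact Nat.succ_pos e
    | succ i => exact (hs i (by omega)).rename fun j hj => Nat.succ_lt_succ hj

theorem Beta.freeBelow {t u : Tm} (h : Beta t u) {d : ℕ} (ht : t.FreeBelow d) :
    u.FreeBelow d := by
  induction h generalizing d with
  | red t u =>
    rw [contract_eq]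
    refine Tm.FreeBelow.subst (d := d + 1) ht.1 fun i hi => ?_
    cases i with
    | zero => exact ht.2
    | succ i => exact Nat.lt_of_succ_lt_succ hi
  | appL t _ ih => exact ⟨ih ht.1, ht.2⟩
  | appR s _ ih => exact ⟨ht.1, ih ht.2⟩
  | lam _ ih => exact ih (d := d + 1) ht

theorem BetaStar.freeBelow {t u : Tm} (h : BetaStar t u) {d : ℕ} (ht : t.FreeBelow d) :
    u.FreeBelow d := by
  induction h with
  | refl => exact ht
  | tail _ h ih => exact h.freeBelow ih

/-! ### Spines and iterated abstractions -/

@[simp] theorem apps_nil (t : Tm) : apps t [] = t := rfl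

@[simp] theorem apps_cons (t u : Tm) (L : List Tm) : apps t (u :: L) = apps (app t u) L := rfl

theorem apps_append (t : Tm) (L L' : List Tm) : apps t (L ++ L') = apps (apps t L) L' :=
  List.foldl_append

theorem apps_concat (t : Tm) (L : List Tm) (u : Tm) : apps t (L ++ [u]) = app (apps t L) u :=
  apps_append t L [u]

theorem apps_subst (t : Tm) (L : List Tm) (s : ℕ → Tm) :
    (apps t L).subst s = apps (t.subst s) (L.map (·.subst s)) := by
  induction L generalizing t with
  | nil => rfl
  | cons u L ih => exact ih _

theorem apps_rename (t : Tm) (L : List Tm) (r : ℕ → ℕ) :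
    (apps t L).rename r = apps (t.rename r) (L.map (·.rename r)) := by
  induction L generalizing t with
  | nil => rfl
  | cons u L ih => exact ih _

theorem apps_freeBelow {t : Tm} {L : List Tm} {d : ℕ} :
    (apps t L).FreeBelow d ↔ t.FreeBelow d ∧ ∀ u ∈ L, u.FreeBelow d := by
  induction L generalizing t with
  | nil => simp
  | cons u L ih =>
    rw [apps_cons, ih]
    simp only [Tm.FreeBelow, List.mem_cons, forall_eq_or_imp, and_assoc]

/-- Extend a substitution under `n` binders. -/
def liftSubN : ℕ → (ℕ → Tm) → ℕ → Tm
  | 0, s => s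
  | n + 1, s => liftSubN n (liftSub s)

theorem lams_subst (n : ℕ) (t : Tm) (s : ℕ → Tm) :
    (lams n t).subst s = lams n (t.subst (liftSubN n s)) := by
  induction n generalizing s with
  | zero => rfl
  | succ n ih => exact congrArg lam (ih _)

theorem liftSubN_add (n j : ℕ) (s : ℕ → Tm) : liftSubN n s (n + j) = (s j).rename (· + n) := by
  induction n generalizing j s with
  | zero =>
    simp only [Nat.zero_add, Nat.add_zero, liftSubN]
    exact (rename_id _).symm
  | succ n ih =>
    have : n + 1 + j = n + (j + 1) := by omega
    rw [this]
    show liftSubN n (liftSub s) (n + (j + 1)) = _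
    rw [ih]
    show ((s j).rename Nat.succ).rename _ = _
    rw [rename_rename]
    congr 1
    funext k
    simp; omega

theorem liftSubN_lt {n i : ℕ} (h : i < n) (s : ℕ → Tm) : liftSubN n s i = var i := by
  induction n generalizing s i with
  | zero => omega
  | succ n ih =>
    by_cases hi : i < n
    · exact ih hi _
    · obtain rfl : i = n := by omega
      have := liftSubN_add i 0 (liftSub s)
      simpa [liftSub, liftSubN, Tm.rename] using this

/-! ### Head reduction -/

/-- One step of weak head reduction. -/
inductive WH : Tm → Tm → Prop
  | red (t u : Tm) : WH (app (lam t) u) (t.contract u)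
  | appL {s s' : Tm} (t : Tm) : WH s s' → WH (app s t) (app s' t)

/-- Weak head reduction in any number of steps. -/
abbrev WHs : Tm → Tm → Prop := Relation.ReflTransGen WH

/-- Terms of the form `apps (var y) L`. -/
def Neutral : Tm → Prop
  | var _ => True
  | app s _ => Neutral s
  | lam _ => False

/-- `t` is head normalizing, and its head normal form begins with exactly `l` abstractions. -/
inductive Hn : ℕ → Tm → Prop
  | neutral {t : Tm} : Neutral t → Hn 0 t
  | lam {l : ℕ} {t : Tm} : Hn l t → Hn (l + 1) (lam t)
  | step {l : ℕ} {t t' : Tm} : WH t t' → Hn l t' → Hn l t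

theorem WH.det {t a b : Tm} (ha : WH t a) (hb : WH t b) : a = b := by
  induction ha generalizing b with
  | red t u =>
    cases hb with
    | red => rfl
    | appL _ h => cases h
  | appL t h ih =>
    cases hb with
    | red => cases h
    | appL _ h' => rw [ih h']

theorem Neutral.not_wh {t u : Tm} (ht : Neutral t) : ¬ WH t u := by
  intro h
  induction h with
  | red => exact ht
  | appL t h ih => exact ih ht

theorem neutral_or_lam_or_wh (t : Tm) : Neutral t ∨ (∃ u, t = lam u) ∨ ∃ u, WH t u := by
  induction t with
  | var n => exact Or.inl trivial
  | lam t _ => exact Or.inr (Or.inl ⟨t, rfl⟩)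
  | app s t hs _ =>
    rcases hs with h | ⟨u, rfl⟩ | ⟨u, h⟩
    · exact Or.inl h
    · exact Or.inr (Or.inr ⟨_, WH.red u t⟩)
    · exact Or.inr (Or.inr ⟨_, WH.appL t h⟩)

theorem Neutral.subst_var {t : Tm} (h : Neutral t) (r : ℕ → ℕ) : Neutral (t.rename r) := by
  induction t with
  | var n => trivial
  | app s t hs _ => exact hs h
  | lam t _ => exact h.elim

theorem neutral_apps {t : Tm} {L : List Tm} : Neutral (apps t L) ↔ Neutral t := by
  induction L generalizing t with
  | nil => rfl
  | cons u L ih => exact ih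

theorem Neutral.exists_apps {t : Tm} (h : Neutral t) : ∃ y L, t = apps (var y) L := by
  induction t with
  | var n => exact ⟨n, [], rfl⟩
  | app s t hs _ =>
    obtain ⟨y, L, rfl⟩ := hs h
    exact ⟨y, L ++ [t], (apps_concat _ _ _).symm⟩
  | lam t _ => exact h.elim

theorem WH.subst {t u : Tm} (h : WH t u) (s : ℕ → Tm) : WH (t.subst s) (u.subst s) := by
  induction h with
  | red t u =>
    rw [contract_subst]
    exact WH.red _ _
  | appL t _ ih => exact WH.appL _ ih

theorem WH.rename {t u : Tm} (h : WH t u) (r : ℕ → ℕ) : WH (t.rename r) (u.rename r) := by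
  rw [rename_eq_subst, rename_eq_subst]
  exact h.subst _

theorem WH.apps {t u : Tm} (h : WH t u) (L : List Tm) : WH (apps t L) (apps u L) := by
  induction L generalizing t u with
  | nil => exact h
  | cons v L ih => exact ih (WH.appL v h)

theorem star_lift {α β : Type*} {r : α → α → Prop} {p : β → β → Prop} (f : α → β)
    (h : ∀ a b, r a b → p (f a) (f b)) {a b : α} (hab : Relation.ReflTransGen r a b) :
    Relation.ReflTransGen p (f a) (f b) :=
  Relation.ReflTransGen.lift f h _ _ hab

theorem WHs.subst {t u : Tm} (h : WHs t u) (s : ℕ → Tm) : WHs (t.subst s) (u.subst s) :=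
  star_lift (Tm.subst s) (fun _ _ h => h.subst s) h

theorem WHs.rename {t u : Tm} (h : WHs t u) (r : ℕ → ℕ) : WHs (t.rename r) (u.rename r) :=
  star_lift (Tm.rename r) (fun _ _ h => h.rename r) h

theorem WHs.apps {t u : Tm} (h : WHs t u) (L : List Tm) : WHs (apps t L) (apps u L) :=
  star_lift (fun t => RangeH.apps t L) (fun _ _ h => h.apps L) h

theorem WHs.appL {t u : Tm} (h : WHs t u) (v : Tm) : WHs (app t v) (app u v) :=
  WHs.apps h [v]

theorem WH.beta {t u : Tm} (h : WH t u) : Beta t u := by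
  induction h with
  | red t u => exact Beta.red t u
  | appL t _ ih => exact Beta.appL t ih

theorem WHs.betaStar {t u : Tm} (h : WHs t u) : BetaStar t u :=
  star_lift id (fun _ _ h => WH.beta h) h

theorem Hn.of_wh {l : ℕ} {t u : Tm} (h : Hn l t) (hw : WH t u) : Hn l u := by
  cases h with
  | neutral h => exact absurd hw h.not_wh
  | lam h => cases hw
  | step hw' h => rwa [hw.det hw']

theorem Hn.whs {l : ℕ} {t u : Tm} (hw : WHs t u) (h : Hn l u) : Hn l t := by
  induction hw using Relation.ReflTransGen.head_induction_on with
  | refl => exact h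
  | head hw _ ih => exact Hn.step hw ih

theorem Hn.rename {l : ℕ} {t : Tm} (h : Hn l t) (r : ℕ → ℕ) : Hn l (t.rename r) := by
  induction h generalizing r with
  | neutral h => exact Hn.neutral (h.subst_var r)
  | lam _ ih => exact Hn.lam (ih _)
  | step hw _ ih => exact Hn.step (hw.rename r) (ih r)

/-! ### Congruence of beta-reduction -/

theorem BetaStar.refl (t : Tm) : BetaStar t t := Relation.ReflTransGen.refl

theorem BetaStar.trans {t u v : Tm} (h : BetaStar t u) (h' : BetaStar u v) : BetaStar t v :=
  Relation.ReflTransGen.trans h h'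

theorem BetaStar.app {s s' t t' : Tm} (h : BetaStar s s') (h' : BetaStar t t') :
    BetaStar (app s t) (app s' t') :=
  (star_lift (fun s => Tm.app s t) (fun _ _ h => Beta.appL t h) h).trans
    (star_lift (fun t => Tm.app s' t) (fun _ _ h => Beta.appR s' h) h')

theorem BetaStar.lam {t t' : Tm} (h : BetaStar t t') : BetaStar (lam t) (lam t') :=
  star_lift Tm.lam (fun _ _ h => Beta.lam h) h

theorem BetaStar.apps {t t' : Tm} {L L' : List Tm} (h : BetaStar t t')
    (hL : List.Forall₂ BetaStar L L') : BetaStar (apps t L) (apps t' L') := by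
  induction hL generalizing t t' with
  | nil => exact h
  | cons hu _ ih => exact ih (h.app hu)

theorem Beta.subst {t u : Tm} (h : Beta t u) (s : ℕ → Tm) : Beta (t.subst s) (u.subst s) := by
  induction h generalizing s with
  | red t u =>
    rw [contract_subst]
    exact Beta.red _ _
  | appL t _ ih => exact Beta.appL _ (ih s)
  | appR t _ ih => exact Beta.appR _ (ih s)
  | lam _ ih => exact Beta.lam (ih _)

theorem BetaStar.subst {t u : Tm} (h : BetaStar t u) (s : ℕ → Tm) :
    BetaStar (t.subst s) (u.subst s) :=
  star_lift (Tm.subst s) (fun _ _ h => h.subst s) h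

theorem Hn.hasHnf {l : ℕ} {t : Tm} (h : Hn l t) : HasHnf t l := by
  induction h with
  | neutral h =>
    obtain ⟨y, L, rfl⟩ := h.exists_apps
    exact ⟨y, L, BetaStar.refl _⟩
  | lam _ ih =>
    obtain ⟨y, L, h⟩ := ih
    exact ⟨y, L, h.lam⟩
  | step hw _ ih =>
    obtain ⟨y, L, h⟩ := ih
    exact ⟨y, L, Relation.ReflTransGen.head hw.beta h⟩

/-! ### Standardization -/

/-- Standard reduction: weak head reduction to the outermost constructor of the result, then
standard reduction of the immediate subterms. -/
inductive St : Tm → Tm → Prop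
  | var {t : Tm} {n : ℕ} : WHs t (var n) → St t (var n)
  | app {t p q p' q' : Tm} : WHs t (app p q) → St p p' → St q q' → St t (app p' q')
  | lam {t p p' : Tm} : WHs t (lam p) → St p p' → St t (lam p')

theorem St.refl (t : Tm) : St t t := by
  induction t with
  | var n => exact St.var .refl
  | app s t hs ht => exact St.app .refl hs ht
  | lam t ht => exact St.lam .refl ht

theorem St.head {t u v : Tm} (h : WHs t u) (h' : St u v) : St t v := by
  cases h' with
  | var h' => exact St.var (h.trans h')
  | app h' hp hq => exact St.app (h.trans h') hp hq
  | lam h' hp => exact St.lam (h.trans h') hp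

theorem St.rename {t u : Tm} (h : St t u) (r : ℕ → ℕ) : St (t.rename r) (u.rename r) := by
  induction h generalizing r with
  | var h => exact St.var (h.rename r)
  | app h _ _ hp hq => exact St.app (h.rename r) (hp r) (hq r)
  | lam h _ hp => exact St.lam (h.rename r) (hp _)

theorem St.subst {t u : Tm} (h : St t u) {s s' : ℕ → Tm} (hs : ∀ i, St (s i) (s' i)) :
    St (t.subst s) (u.subst s') := by
  induction h generalizing s s' with
  | var h => exact St.head (h.subst s) (hs _)
  | app h _ _ hp hq => exact St.app (h.subst s) (hp hs) (hq hs)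
  | lam h _ hp =>
    refine St.lam (h.subst s) (hp fun i => ?_)
    cases i with
    | zero => exact St.refl _
    | succ i => exact (hs i).rename _

theorem St.beta {t u v : Tm} (h : St t u) (hb : Beta u v) : St t v := by
  induction hb generalizing t with
  | red a b =>
    cases h with
    | app h hp hq =>
      cases hp with
      | lam h' hp =>
        refine St.head ((h.trans (h'.appL _)).tail (WH.red _ _)) ?_
        rw [contract_eq, contract_eq]
        refine hp.subst fun i => ?_
        cases i with
        | zero => exact hq
        | succ i => exact St.refl _
  | appL _ _ ih =>
    cases h with
    | app h hp hq => exact St.app h (ih hp) hq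
  | appR _ _ ih =>
    cases h with
    | app h hp hq => exact St.app h hp (ih hq)
  | lam _ ih =>
    cases h with
    | lam h hp => exact St.lam h (ih hp)

theorem BetaStar.st {t u : Tm} (h : BetaStar t u) : St t u := by
  induction h with
  | refl => exact St.refl _
  | tail _ h ih => exact ih.beta h

theorem St.whs_apps_var {t : Tm} {y : ℕ} {L : List Tm} (h : St t (apps (Tm.var y) L)) :
    ∃ L', L'.length = L.length ∧ WHs t (apps (Tm.var y) L') := by
  induction L using List.reverseRecOn generalizing t with
  | nil =>
    cases h with
    | var h => exact ⟨[], rfl, h⟩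
  | append_singleton L u ih =>
    rw [apps_concat] at h
    cases h with
    | @app _ p q _ _ h hp hq =>
      obtain ⟨L', hL, h'⟩ := ih hp
      refine ⟨L' ++ [q], by simp [hL], ?_⟩
      rw [apps_concat]
      exact h.trans (h'.appL _)

theorem St.hn {t : Tm} {l y : ℕ} {L : List Tm} (h : St t (lams l (apps (Tm.var y) L))) :
    Hn l t := by
  induction l generalizing t with
  | zero =>
    obtain ⟨L', _, h⟩ := St.whs_apps_var h
    exact Hn.whs h (Hn.neutral (neutral_apps.2 trivial))
  | succ l ih =>
    cases h with
    | lam h hp => exact Hn.whs h (Hn.lam (ih hp))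

theorem HasHnf.hn {t : Tm} {l : ℕ} (h : HasHnf t l) : Hn l t := by
  obtain ⟨y, L, h⟩ := h
  exact h.st.hn

/-! ### Solvable terms -/

theorem solvable_iff {t : Tm} : Solvable t ↔ ∃ l, Hn l t :=
  exists_congr fun _ => ⟨HasHnf.hn, Hn.hasHnf⟩

theorem Hn.solvable {t : Tm} {l : ℕ} (h : Hn l t) : Solvable t := ⟨l, h.hasHnf⟩

theorem Hn.of_subst {l : ℕ} {t : Tm} {s : ℕ → Tm} (h : Hn l (t.subst s)) : ∃ l', Hn l' t := by
  generalize hu : t.subst s = u at h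
  induction h generalizing t s with
  | neutral h =>
    rcases neutral_or_lam_or_wh t with ht | ⟨p, rfl⟩ | ⟨p, hp⟩
    · exact ⟨0, Hn.neutral ht⟩
    · subst hu; exact h.elim
    · subst hu; exact absurd (hp.subst s) h.not_wh
  | lam h ih =>
    rcases neutral_or_lam_or_wh t with ht | ⟨p, rfl⟩ | ⟨p, hp⟩
    · exact ⟨0, Hn.neutral ht⟩
    · obtain ⟨l', h'⟩ := ih (Tm.lam.inj hu)
      exact ⟨_, h'.lam⟩
    · have := hp.subst s
      rw [hu] at this
      cases this
  | step hw h ih =>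
    rcases neutral_or_lam_or_wh t with ht | ⟨p, rfl⟩ | ⟨p, hp⟩
    · exact ⟨0, Hn.neutral ht⟩
    · subst hu; cases hw
    · subst hu
      obtain ⟨l', h'⟩ := ih ((hp.subst s).det hw)
      exact ⟨_, Hn.step hp h'⟩

theorem Hn.of_app {l : ℕ} {t u : Tm} (h : Hn l (app t u)) : ∃ l', Hn l' t := by
  generalize hv : app t u = v at h
  induction h generalizing t with
  | neutral h => subst hv; exact ⟨0, Hn.neutral h⟩
  | lam h => cases hv
  | step hw h ih =>
    subst hv
    cases hw with
    | red p _ =>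
      rw [contract_eq] at h
      obtain ⟨l', h'⟩ := h.of_subst
      exact ⟨_, h'.lam⟩
    | appL _ hw =>
      obtain ⟨l', h'⟩ := ih rfl
      exact ⟨l', Hn.step hw h'⟩

theorem Hn.of_apps {l : ℕ} {t : Tm} {L : List Tm} (h : Hn l (apps t L)) : ∃ l', Hn l' t := by
  induction L generalizing t l with
  | nil => exact ⟨l, h⟩
  | cons u L ih =>
    obtain ⟨l', h'⟩ := ih h
    exact h'.of_app

theorem Hn.of_lam {l : ℕ} {t : Tm} (h : Hn l (Tm.lam t)) : ∃ l', l = l' + 1 ∧ Hn l' t := by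
  cases h with
  | neutral h => exact h.elim
  | lam h => exact ⟨_, rfl, h⟩
  | step hw => cases hw

theorem Solvable.of_app {t u : Tm} (h : Solvable (app t u)) : Solvable t := by
  obtain ⟨l, h⟩ := solvable_iff.1 h
  exact solvable_iff.2 h.of_app

theorem Solvable.of_subst {t : Tm} {s : ℕ → Tm} (h : Solvable (t.subst s)) : Solvable t := by
  obtain ⟨l, h⟩ := solvable_iff.1 h
  exact solvable_iff.2 h.of_subst

theorem Solvable.of_lam {t : Tm} (h : Solvable (lam t)) : Solvable t := by
  obtain ⟨l, h⟩ := solvable_iff.1 h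
  obtain ⟨l', _, h⟩ := h.of_lam
  exact h.solvable

theorem Solvable.lam {t : Tm} (h : Solvable t) : Solvable (Tm.lam t) := by
  obtain ⟨l, h⟩ := solvable_iff.1 h
  exact h.lam.solvable

theorem Neutral.solvable {t : Tm} (h : Neutral t) : Solvable t := (Hn.neutral h).solvable

/-- Feeding a head normalizing term a variable uses up at most one abstraction. -/
theorem Hn.app_var {l : ℕ} {t : Tm} (h : Hn l t) (y : ℕ) :
    ∃ l' ≤ l, Hn l' (app t (var y)) := by
  induction h with
  | neutral h => exact ⟨0, le_rfl, Hn.neutral h⟩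
  | lam h _ =>
    refine ⟨_, Nat.le_succ _, Hn.step (WH.red _ _) ?_⟩
    rw [contract_var_eq_rename]
    exact h.rename _
  | step hw _ ih =>
    obtain ⟨l', hl, h⟩ := ih
    exact ⟨l', hl, Hn.step (WH.appL _ hw) h⟩

theorem Hn.apps_var {l : ℕ} {t : Tm} (h : Hn l t) (L : List ℕ) :
    ∃ l' ≤ l, Hn l' (apps t (L.map var)) := by
  induction L generalizing t l with
  | nil => exact ⟨l, le_rfl, h⟩
  | cons y L ih =>
    obtain ⟨l', hl, h'⟩ := h.app_var y
    obtain ⟨l'', hl', h''⟩ := ih h'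
    exact ⟨l'', hl'.trans hl, h''⟩

/-- The abstractions of a head normal form survive substitution, and each further argument uses up
at most one of them. -/
theorem Hn.le_of_subst_apps {l : ℕ} {t : Tm} (h : Hn l t) {s : ℕ → Tm} {L : List Tm} {q : ℕ}
    (hq : Hn q (apps (t.subst s) L)) : l ≤ q + L.length := by
  induction h generalizing s L q with
  | neutral => exact Nat.zero_le _
  | @lam l t h ih =>
    cases L with
    | nil =>
      obtain ⟨q', rfl, hq'⟩ := Hn.of_lam hq
      have := ih (L := []) hq'
      simpa using this
    | cons u L =>
      have h1 := hq.of_wh (WH.apps (WH.red _ u) L)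
      rw [liftSub_contract] at h1
      have := ih h1
      simp only [List.length_cons]
      omega
  | step hw _ ih => exact ih (hq.of_wh (WH.apps (hw.subst s) L))

/-! ### Parallel reduction -/

/-- Parallel beta-Omega-reduction: some of the beta-redexes of a term are contracted and some of
its unsolvable subterms are replaced by `Ω`, all at the same time. -/
inductive Par : Tm → Tm → Prop
  | var (n : ℕ) : Par (var n) (var n)
  | app {s s' t t' : Tm} : Par s s' → Par t t' → Par (app s t) (app s' t')
  | lam {t t' : Tm} : Par t t' → Par (lam t) (lam t')
  | red {t t' u u' : Tm} : Par t t' → Par u u' → Par (app (lam t) u) (t'.contract u')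
  | om {t : Tm} : ¬ Solvable t → Par t omega

/-- Parallel reduction in any number of steps. -/
abbrev Pars : Tm → Tm → Prop := Relation.ReflTransGen Par

theorem Par.refl (t : Tm) : Par t t := by
  induction t with
  | var n => exact Par.var n
  | app s t hs ht => exact Par.app hs ht
  | lam t ht => exact Par.lam ht

theorem Par.rename {t u : Tm} (h : Par t u) (r : ℕ → ℕ) : Par (t.rename r) (u.rename r) := by
  induction h generalizing r with
  | var n => exact Par.refl _
  | app _ _ hs ht => exact Par.app (hs r) (ht r)
  | lam _ ht => exact Par.lam (ht _)
  | red _ _ ht hu =>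
    rw [contract_rename]
    exact Par.red (ht _) (hu r)
  | om h =>
    refine Par.om fun h' => h ?_
    rw [rename_eq_subst] at h'
    exact h'.of_subst

theorem Par.subst {t u : Tm} (h : Par t u) {s s' : ℕ → Tm} (hs : ∀ i, Par (s i) (s' i)) :
    Par (t.subst s) (u.subst s') := by
  have lift : ∀ {s s' : ℕ → Tm}, (∀ i, Par (s i) (s' i)) →
      ∀ i, Par (liftSub s i) (liftSub s' i) := by
    intro s s' hs i
    cases i with
    | zero => exact Par.refl _
    | succ i => exact (hs i).rename _
  induction h generalizing s s' with
  | var n => exact hs n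
  | app _ _ hp hq => exact Par.app (hp hs) (hq hs)
  | lam _ hp => exact Par.lam (hp (lift hs))
  | red _ _ hp hq =>
    rw [contract_subst]
    exact Par.red (hp (lift hs)) (hq hs)
  | om h => exact Par.om fun h' => h h'.of_subst

theorem Beta.par {t u : Tm} (h : Beta t u) : Par t u := by
  induction h with
  | red t u => exact Par.red (Par.refl t) (Par.refl u)
  | appL t _ ih => exact Par.app ih (Par.refl t)
  | appR s _ ih => exact Par.app (Par.refl s) ih
  | lam _ ih => exact Par.lam ih

theorem OmegaStep.par {t u : Tm} (h : OmegaStep t u) : Par t u := by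
  induction h with
  | red t h => exact Par.om h
  | appL t _ ih => exact Par.app ih (Par.refl t)
  | appR s _ ih => exact Par.app (Par.refl s) ih
  | lam _ ih => exact Par.lam ih

theorem BetaOmegaStar.pars {t u : Tm} (h : BetaOmegaStar t u) : Pars t u :=
  star_lift id (fun _ _ h => h.elim Beta.par OmegaStep.par) h

theorem Par.of_app {s t u : Tm} (h : Par (Tm.app s t) u) (hs : Solvable (Tm.app s t))
    (hl : ∀ p, s ≠ Tm.lam p) : ∃ s' t', u = Tm.app s' t' ∧ Par s s' ∧ Par t t' := by
  cases h with
  | app hs ht => exact ⟨_, _, rfl, hs, ht⟩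
  | red => exact absurd rfl (hl _)
  | om h => exact absurd hs h

theorem Par.of_lam {t u : Tm} (h : Par (Tm.lam t) u) (hs : Solvable (Tm.lam t)) :
    ∃ t', u = Tm.lam t' ∧ Par t t' := by
  cases h with
  | lam h => exact ⟨_, rfl, h⟩
  | om h => exact absurd hs h

theorem Par.of_var {n : ℕ} {u : Tm} (h : Par (Tm.var n) u) : u = Tm.var n := by
  cases h with
  | var => rfl
  | om h => exact absurd (Neutral.solvable (t := Tm.var n) trivial) h

theorem Par.of_apps {s u : Tm} {L : List Tm} (h : Par (apps s L) u) (hs : Solvable (apps s L))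
    (hl : ∀ p, s ≠ Tm.lam p) :
    ∃ s' L', u = apps s' L' ∧ Par s s' ∧ List.Forall₂ Par L L' := by
  induction L generalizing s u with
  | nil => exact ⟨u, [], rfl, h, .nil⟩
  | cons t L ih =>
    obtain ⟨v, L', rfl, hv, hL⟩ := ih h hs fun p hp => Tm.noConfusion hp
    obtain ⟨l, hn⟩ := solvable_iff.1 hs
    obtain ⟨s', t', rfl, hs', ht'⟩ := hv.of_app (solvable_iff.2 (Hn.of_apps hn)) hl
    exact ⟨s', t' :: L', rfl, hs', .cons ht' hL⟩

theorem Neutral.par {t u : Tm} (ht : Neutral t) (h : Par t u) : Neutral u := by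
  obtain ⟨y, L, rfl⟩ := ht.exists_apps
  obtain ⟨s', L', rfl, hs, _⟩ := h.of_apps ht.solvable fun p hp => Tm.noConfusion hp
  rw [hs.of_var]
  exact neutral_apps.2 trivial

/-- Parallel reduction commutes with weak head reduction of solvable terms, where the latter takes
at most one step again. -/
theorem Par.wh {t t₁ t₂ : Tm} (hw : WH t t₁) (hp : Par t t₂) (hs : Solvable t) :
    ∃ t₃, Par t₁ t₃ ∧ (t₂ = t₃ ∨ WH t₂ t₃) := by
  induction hw generalizing t₂ with
  | red p u =>
    cases hp with
    | app h hu =>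
      obtain ⟨p', rfl, hp'⟩ := h.of_lam hs.of_app
      refine ⟨p'.contract _, ?_, Or.inr (WH.red _ _)⟩
      rw [contract_eq, contract_eq]
      refine hp'.subst fun i => ?_
      cases i with
      | zero => exact hu
      | succ i => exact Par.refl _
    | red hp' hu =>
      refine ⟨_, ?_, Or.inl rfl⟩
      rw [contract_eq, contract_eq]
      refine hp'.subst fun i => ?_
      cases i with
      | zero => exact hu
      | succ i => exact Par.refl _
    | om h => exact absurd hs h
  | appL u hw ih =>
    cases hp with
    | app h hu =>
      obtain ⟨t₃, h3, h3'⟩ := ih h hs.of_app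
      refine ⟨Tm.app t₃ _, h3.app hu, ?_⟩
      rcases h3' with rfl | h3'
      · exact Or.inl rfl
      · exact Or.inr (WH.appL _ h3')
    | red => cases hw
    | om h => exact absurd hs h

theorem apps_app_ne_lam (s t : Tm) (L : List Tm) (p : Tm) : apps (app s t) L ≠ lam p := by
  induction L generalizing s t with
  | nil => exact fun h => Tm.noConfusion h
  | cons u L ih => exact ih _ _

/-! ### Head reduction below abstractions -/

/-- One step of head reduction. -/
inductive HD : Tm → Tm → Prop
  | wh {t u : Tm} : WH t u → HD t u
  | lam {t u : Tm} : HD t u → HD (lam t) (lam u)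

/-- Head reduction in any number of steps. -/
abbrev HDs : Tm → Tm → Prop := Relation.ReflTransGen HD

theorem WHs.hds {t u : Tm} (h : WHs t u) : HDs t u := star_lift id (fun _ _ h => HD.wh h) h

theorem HD.subst {t u : Tm} (h : HD t u) (s : ℕ → Tm) : HD (t.subst s) (u.subst s) := by
  induction h generalizing s with
  | wh h => exact HD.wh (h.subst s)
  | lam _ ih => exact HD.lam (ih _)

theorem HDs.subst {t u : Tm} (h : HDs t u) (s : ℕ → Tm) : HDs (t.subst s) (u.subst s) :=
  star_lift (Tm.subst s) (fun _ _ h => h.subst s) h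

theorem HDs.lam {t u : Tm} (h : HDs t u) : HDs (lam t) (lam u) :=
  star_lift Tm.lam (fun _ _ h => HD.lam h) h

theorem HD.hn {l : ℕ} {t u : Tm} (h : HD t u) (hu : Hn l u) : Hn l t := by
  induction h generalizing l with
  | wh h => exact Hn.step h hu
  | lam _ ih =>
    obtain ⟨l', rfl, hu'⟩ := hu.of_lam
    exact (ih hu').lam

theorem HDs.hn {l : ℕ} {t u : Tm} (h : HDs t u) (hu : Hn l u) : Hn l t := by
  induction h using Relation.ReflTransGen.head_induction_on with
  | refl => exact hu
  | head h _ ih => exact h.hn ih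

theorem Par.hd {t t₁ t₂ : Tm} (hw : HD t t₁) (hp : Par t t₂) (hs : Solvable t) :
    ∃ t₃, Par t₁ t₃ ∧ HDs t₂ t₃ := by
  induction hw generalizing t₂ with
  | wh h =>
    obtain ⟨t₃, h3, h3'⟩ := hp.wh h hs
    refine ⟨t₃, h3, ?_⟩
    rcases h3' with rfl | h3'
    · exact .refl
    · exact .single (HD.wh h3')
  | lam _ ih =>
    obtain ⟨u, rfl, hu⟩ := hp.of_lam hs
    obtain ⟨t₃, h3, h3'⟩ := ih hu hs.of_lam
    exact ⟨_, h3.lam, h3'.lam⟩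

theorem Par.hds {t t₁ t₂ : Tm} (hw : HDs t t₁) (hp : Par t t₂) (hs : Solvable t₁) :
    ∃ t₃, Par t₁ t₃ ∧ HDs t₂ t₃ := by
  induction hw using Relation.ReflTransGen.head_induction_on generalizing t₂ with
  | refl => exact ⟨t₂, hp, .refl⟩
  | head h h' ih =>
    obtain ⟨l, hn⟩ := solvable_iff.1 hs
    obtain ⟨t₃, h3, h3'⟩ := hp.hd h (h.hn (HDs.hn h' hn)).solvable
    obtain ⟨t₄, h4, h4'⟩ := ih h3
    exact ⟨t₄, h4, h3'.trans h4'⟩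

/-! ### The last argument of the head normal form -/

/-- `Arg t v`: the head normal form that head reduction finds for `t` has a last argument, and this
argument is literally the term `v` (in the scope of the abstractions of the head normal form). -/
inductive Arg : Tm → Tm → Prop
  | arg {s t : Tm} : Neutral s → Arg (app s t) t
  | lam {t v : Tm} : Arg t v → Arg (lam t) v
  | step {t u v : Tm} : WH t u → Arg u v → Arg t v

theorem Arg.of_wh {t u v : Tm} (h : Arg t v) (hw : WH t u) : Arg u v := by
  cases h with
  | arg h => exact absurd hw (Neutral.not_wh (t := Tm.app _ v) h)
  | lam h => cases hw
  | step hw' h => rwa [hw.det hw']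

theorem Arg.of_whs {t u v : Tm} (h : Arg t v) (hw : WHs t u) : Arg u v := by
  induction hw with
  | refl => exact h
  | tail _ hw ih => exact ih.of_wh hw

theorem Arg.whs {t u v : Tm} (hw : WHs t u) (h : Arg u v) : Arg t v := by
  induction hw using Relation.ReflTransGen.head_induction_on with
  | refl => exact h
  | head hw _ ih => exact Arg.step hw ih

theorem Arg.of_lam {t v : Tm} (h : Arg (Tm.lam t) v) : Arg t v := by
  cases h with
  | lam h => exact h
  | step hw => cases hw

theorem Arg.det {t v w : Tm} (h : Arg t v) (h' : Arg t w) : v = w := by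
  induction h with
  | arg h =>
    cases h' with
    | arg => rfl
    | step hw => exact absurd hw (Neutral.not_wh (t := Tm.app _ _) h)
  | lam _ ih => exact ih h'.of_lam
  | step hw _ ih => exact ih (h'.of_wh hw)

theorem Arg.solvable {t v : Tm} (h : Arg t v) : Solvable t := by
  induction h with
  | arg h => exact Neutral.solvable (t := Tm.app _ _) h
  | lam _ ih => exact ih.lam
  | step hw _ ih =>
    obtain ⟨l, h⟩ := solvable_iff.1 ih
    exact (Hn.step hw h).solvable

/-- Parallel reduction of a term projects to parallel reduction of the last argument. -/
theorem Arg.par {t v t' : Tm} (h : Arg t v) (hp : Par t t') : ∃ v', Arg t' v' ∧ Par v v' := by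
  induction h generalizing t' with
  | arg h =>
    obtain ⟨s', u', rfl, hs, hu⟩ := hp.of_app (Neutral.solvable (t := Tm.app _ _) h)
      (by rintro p rfl; exact h)
    exact ⟨u', Arg.arg (h.par hs), hu⟩
  | lam h ih =>
    obtain ⟨u, rfl, hu⟩ := hp.of_lam h.solvable.lam
    obtain ⟨v', h1, h2⟩ := ih hu
    exact ⟨v', h1.lam, h2⟩
  | step hw h ih =>
    obtain ⟨t₃, h3, h3'⟩ := hp.wh hw (Arg.step hw h).solvable
    obtain ⟨v', h1, h2⟩ := ih h3
    refine ⟨v', ?_, h2⟩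
    rcases h3' with rfl | h3'
    · exact h1
    · exact h1.step h3'

/-- A term that reduces to an abstraction may be given a fresh variable first. -/
theorem Arg.eta {t p v : Tm} (hw : WHs t (Tm.lam p))
    (h : Arg (app (t.rename Nat.succ) (var 0)) v) : Arg t v := by
  refine Arg.whs hw (Arg.lam ?_)
  have h1 : WHs (app (t.rename Nat.succ) (var 0)) p := by
    have := ((hw.rename Nat.succ).appL (var 0)).tail (WH.red _ _)
    rwa [liftRen_succ_contract_var] at this
  exact h.of_whs h1

/-- Head reduction below abstractions may be done before these abstractions get their
arguments. -/
theorem Arg.hd_apps {t u v : Tm} (h : HD t u) {s : ℕ → Tm} {L : List Tm}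
    (hv : Arg (apps (u.subst s) L) v) : Arg (apps (t.subst s) L) v := by
  induction h generalizing s L with
  | wh h => exact Arg.step ((h.subst s).apps L) hv
  | lam _ ih =>
    cases L with
    | nil => exact Arg.lam (ih (L := []) hv.of_lam)
    | cons z L =>
      have h1 := hv.of_wh (WH.apps (WH.red _ z) L)
      rw [liftSub_contract] at h1
      refine Arg.step (WH.apps (WH.red _ z) L) ?_
      rw [liftSub_contract]
      exact ih h1

theorem Arg.hds_apps {t u v : Tm} (h : HDs t u) {L : List Tm} (hv : Arg (apps u L) v) :
    Arg (apps t L) v := by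
  induction h using Relation.ReflTransGen.head_induction_on with
  | refl => exact hv
  | @head a b h _ ih =>
    have := Arg.hd_apps h (s := var) (L := L) (v := v)
    rw [subst_var, subst_var] at this
    exact this ih

theorem whs_lam_of_hd_apps {t u : Tm} (h : HD t u) {s : ℕ → Tm} {L : List Tm}
    (hv : ∃ p, WHs (apps (u.subst s) L) (lam p)) : ∃ p, WHs (apps (t.subst s) L) (lam p) := by
  induction h generalizing s L with
  | wh h => exact hv.imp fun _ hp => .head ((h.subst s).apps L) hp
  | @lam _ u _ ih =>
    cases L with
    | nil => exact ⟨_, .refl⟩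
    | cons z L =>
      obtain ⟨p, hp⟩ := hv
      have h1 : ∃ p, WHs (apps ((u.subst (liftSub s)).contract z) L) (lam p) := by
        rcases hp.cases_head with h | ⟨c, hc, hp⟩
        · exact absurd h (apps_app_ne_lam _ _ _ _)
        · rw [← (WH.apps (WH.red _ z) L).det hc] at hp
          exact ⟨p, hp⟩
      rw [liftSub_contract] at h1
      obtain ⟨p, hp⟩ := ih h1
      refine ⟨p, .head (WH.apps (WH.red _ z) L) ?_⟩
      rwa [liftSub_contract]

theorem whs_lam_of_hds_apps {t u : Tm} (h : HDs t u) {L : List Tm}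
    (hv : ∃ p, WHs (apps u L) (lam p)) : ∃ p, WHs (apps t L) (lam p) := by
  induction h using Relation.ReflTransGen.head_induction_on with
  | refl => exact hv
  | head h _ ih =>
    have := whs_lam_of_hd_apps h (s := var) (L := L)
    rw [subst_var, subst_var] at this
    exact this ih

/-- The substitution that assigns the terms of a list, the last one first, to the first variables
and follows `s` after that. -/
def instList : List Tm → (ℕ → Tm) → ℕ → Tm
  | [], s => s
  | z :: L, s => instList L (scons z s)

theorem instList_add (L : List Tm) (s : ℕ → Tm) (i : ℕ) : instList L s (i + L.length) = s i := by
  induction L generalizing s i with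
  | nil => rfl
  | cons z L ih =>
    have : i + (z :: L).length = (i + 1) + L.length := by simp only [List.length_cons]; omega
    rw [this]
    exact ih _ _

theorem instList_get (L : List Tm) (s : ℕ → Tm) (j : ℕ) (hj : j < L.length) :
    instList L s (L.length - 1 - j) = L[j] := by
  induction L generalizing s j with
  | nil => exact absurd hj (Nat.not_lt_zero j)
  | cons z L ih =>
    cases j with
    | zero =>
      have := instList_add L (scons z s) 0
      simpa [scons, instList] using this
    | succ j =>
      have h' : j < L.length := by simpa using hj
      have : (z :: L).length - 1 - (j + 1) = L.length - 1 - j := by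
        simp only [List.length_cons]; omega
      rw [this]
      simpa [instList] using ih (scons z s) j h'

theorem whs_lams_apps (L : List Tm) (b : Tm) (s : ℕ → Tm) :
    WHs (apps ((lams L.length b).subst s) L) (b.subst (instList L s)) := by
  induction L generalizing s with
  | nil => exact .refl
  | cons z L ih =>
    have h1 : WH (apps ((lams (z :: L).length b).subst s) (z :: L))
        (apps ((lams L.length b).subst (scons z s)) L) := by
      rw [← liftSub_contract]
      exact WH.apps (WH.red _ _) L
    exact Relation.ReflTransGen.head h1 (ih _)

theorem whs_lams_apps_lam {n : ℕ} (L : List Tm) (hL : L.length < n) (b : Tm) (s : ℕ → Tm) :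
    ∃ p, WHs (apps ((lams n b).subst s) L) (lam p) := by
  obtain ⟨m, rfl⟩ : ∃ m, n = L.length + (m + 1) := ⟨n - L.length - 1, by omega⟩
  have h : lams (L.length + (m + 1)) b = lams L.length (lams (m + 1) b) := by
    generalize L.length = k
    induction k with
    | zero => rw [Nat.zero_add]; rfl
    | succ k ih => rw [Nat.succ_add]; exact congrArg lam ih
  rw [h]
  exact ⟨_, whs_lams_apps L _ s⟩

/-! ### Equality in the theory -/

theorem OmegaStep.subst {t u : Tm} (h : OmegaStep t u) (s : ℕ → Tm) :
    OmegaStep (t.subst s) (u.subst s) := by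
  induction h generalizing s with
  | red t h => exact OmegaStep.red _ fun h' => h h'.of_subst
  | appL t _ ih => exact OmegaStep.appL _ (ih s)
  | appR t _ ih => exact OmegaStep.appR _ (ih s)
  | lam _ ih => exact OmegaStep.lam (ih _)

theorem EqH.subst {t u : Tm} (h : EqH t u) (s : ℕ → Tm) : EqH (t.subst s) (u.subst s) := by
  obtain ⟨w, h1, h2⟩ := h
  have key : ∀ {a b : Tm}, BetaOmegaStar a b → BetaOmegaStar (a.subst s) (b.subst s) :=
    star_lift (Tm.subst s) fun _ _ h => h.imp (fun h => h.subst s) fun h => h.subst s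
  exact ⟨w.subst s, key h1, key h2⟩

theorem EqH.app {t u : Tm} (h : EqH t u) (v : Tm) : EqH (app t v) (app u v) := by
  obtain ⟨w, h1, h2⟩ := h
  have key : ∀ {a b : Tm}, BetaOmegaStar a b → BetaOmegaStar (Tm.app a v) (Tm.app b v) :=
    star_lift (fun t => Tm.app t v) fun _ _ h => h.imp (Beta.appL v) (OmegaStep.appL v)
  exact ⟨Tm.app w v, key h1, key h2⟩

theorem EqH.apps {t u : Tm} (h : EqH t u) (L : List Tm) : EqH (apps t L) (apps u L) := by
  induction L generalizing t u with
  | nil => exact h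
  | cons v L ih => exact ih (h.app v)

/-! ### Numerals -/

theorem subst_iterate_app (n : ℕ) (f x : Tm) (s : ℕ → Tm) :
    ((app f)^[n] x).subst s = (app (f.subst s))^[n] (x.subst s) := by
  induction n with
  | zero => rfl
  | succ n ih => simp [Function.iterate_succ_apply', Tm.subst, ih]

theorem church_closed (n : ℕ) : (church n).Closed := by
  show ((app (var 1))^[n] (var 0)).FreeBelow 2
  induction n with
  | zero => exact Nat.succ_pos 1
  | succ n ih =>
    rw [Function.iterate_succ_apply']
    exact ⟨Nat.lt_succ_self 1, ih⟩

theorem church_injective : Function.Injective church := by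
  intro n m h
  have h1 : (app (var 1))^[n] (var 0) = (app (var 1))^[m] (var 0) := Tm.lam.inj (Tm.lam.inj h)
  clear h
  induction n generalizing m with
  | zero =>
    cases m with
    | zero => rfl
    | succ m => rw [Function.iterate_succ_apply'] at h1; cases h1
  | succ n ih =>
    cases m with
    | zero => rw [Function.iterate_succ_apply'] at h1; cases h1
    | succ m =>
      rw [Function.iterate_succ_apply', Function.iterate_succ_apply'] at h1
      rw [ih (Tm.app.inj h1).2]

theorem Par.of_church {n : ℕ} {t : Tm} (h : Par (church n) t) : t = church n := by
  have hn : Neutral ((Tm.app (Tm.var 1))^[n] (Tm.var 0)) := by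
    cases n with
    | zero => trivial
    | succ n => rw [Function.iterate_succ_apply']; trivial
  obtain ⟨u, rfl, h1⟩ := Par.of_lam h hn.solvable.lam.lam
  obtain ⟨v, rfl, h2⟩ := Par.of_lam h1 hn.solvable.lam
  refine congrArg Tm.lam (congrArg Tm.lam ?_)
  clear h h1 hn
  induction n generalizing v with
  | zero => exact h2.of_var
  | succ n ih =>
    rw [Function.iterate_succ_apply'] at h2 ⊢
    obtain ⟨f, x, rfl, hf, hx⟩ := h2.of_app (Neutral.solvable (t := Tm.app _ _) trivial)
      fun p hp => Tm.noConfusion hp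
    rw [hf.of_var, ih _ hx]

/-! ### Parallel reduction and head normal forms -/

theorem forall₂_append_left {α β : Type*} {R : α → β → Prop} {a b : List α} {L : List β}
    (h : List.Forall₂ R (a ++ b) L) :
    ∃ x y, L = x ++ y ∧ List.Forall₂ R a x ∧ List.Forall₂ R b y := by
  induction a generalizing L with
  | nil => exact ⟨[], L, rfl, .nil, h⟩
  | cons u a ih =>
    cases h with
    | cons h1 h2 =>
      obtain ⟨x, y, rfl, hx, hy⟩ := ih h2
      exact ⟨_ :: x, y, rfl, .cons h1 hx, hy⟩

theorem exists_of_forall₂_right {α β : Type*} {R : α → β → Prop} {L : List α} {L' : List β}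
    (h : List.Forall₂ R L L') {y : β} (hy : y ∈ L') : ∃ x ∈ L, R x y := by
  induction h with
  | nil => simp at hy
  | cons h1 _ ih =>
    rcases List.mem_cons.1 hy with rfl | hy
    · exact ⟨_, by simp, h1⟩
    · obtain ⟨x, hx, hxy⟩ := ih hy
      exact ⟨x, by simp [hx], hxy⟩

theorem forall₂_comp {α β γ : Type*} {R : α → β → Prop} {S : β → γ → Prop} {T : α → γ → Prop}
    (hRS : ∀ a b c, R a b → S b c → T a c) {L : List α} {L' : List β} {L'' : List γ}
    (h : List.Forall₂ R L L') (h' : List.Forall₂ S L' L'') : List.Forall₂ T L L'' := by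
  induction h generalizing L'' with
  | nil => cases h'; exact .nil
  | cons h1 _ ih =>
    cases h' with
    | cons h2 h3 => exact .cons (hRS _ _ _ h1 h2) (ih h3)

theorem Hn.par {l : ℕ} {t t' : Tm} (h : Hn l t) (hp : Par t t') : Hn l t' := by
  induction h generalizing t' with
  | neutral h => exact Hn.neutral (h.par hp)
  | lam h ih =>
    obtain ⟨u, rfl, hu⟩ := hp.of_lam h.solvable.lam
    exact (ih hu).lam
  | step hw h ih =>
    obtain ⟨u, hu, hu'⟩ := hp.wh hw (Hn.step hw h).solvable
    rcases hu' with rfl | hu'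
    · exact ih hu
    · exact Hn.step hu' (ih hu)

theorem Solvable.par {t t' : Tm} (h : Solvable t) (hp : Par t t') : Solvable t' := by
  obtain ⟨l, h⟩ := solvable_iff.1 h
  exact (h.par hp).solvable

theorem Pars.hds {t t₁ t₂ : Tm} (hp : Pars t t₂) (hw : HDs t t₁) (hs : Solvable t₁) :
    ∃ t₃, Pars t₁ t₃ ∧ HDs t₂ t₃ := by
  induction hp using Relation.ReflTransGen.head_induction_on generalizing t₁ with
  | refl => exact ⟨t₁, .refl, hw⟩
  | head h _ ih =>
    obtain ⟨u, h1, h2⟩ := h.hds hw hs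
    obtain ⟨v, h3, h4⟩ := ih h2 (hs.par h1)
    exact ⟨v, .head h1 h3, h4⟩

theorem Pars.apps {s s' : Tm} {L L' : List Tm} (h : Pars s s') (hL : List.Forall₂ Pars L L') :
    Pars (apps s L) (apps s' L') := by
  induction hL generalizing s s' with
  | nil => exact h
  | @cons a b _ _ hu _ ih =>
    exact ih ((star_lift (fun s => Tm.app s a) (fun _ _ h => h.app (Par.refl a)) h).trans
      (star_lift (fun t => Tm.app s' t) (fun _ _ h => (Par.refl s').app h) hu))

theorem hn_lams_apps_var (a y : ℕ) (L : List Tm) : Hn a (lams a (apps (var y) L)) := by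
  induction a with
  | zero => exact Hn.neutral (neutral_apps.2 trivial)
  | succ a ih => exact ih.lam

theorem Par.of_lams_apps_var {a y : ℕ} {L : List Tm} {t : Tm}
    (h : Par (lams a (RangeH.apps (Tm.var y) L)) t) :
    ∃ L', t = lams a (RangeH.apps (Tm.var y) L') ∧ List.Forall₂ Par L L' := by
  induction a generalizing t with
  | zero =>
    obtain ⟨s, L', rfl, hs, hL⟩ :=
      h.of_apps (hn_lams_apps_var 0 y L).solvable fun p hp => Tm.noConfusion hp
    exact ⟨L', by rw [hs.of_var]; rfl, hL⟩
  | succ a ih =>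
    obtain ⟨u, rfl, hu⟩ := Par.of_lam h (hn_lams_apps_var (a + 1) y L).solvable
    obtain ⟨L', rfl, hL⟩ := ih hu
    exact ⟨L', rfl, hL⟩

theorem Pars.of_lams_apps_var {a y : ℕ} {L : List Tm} {t : Tm}
    (h : Pars (lams a (RangeH.apps (Tm.var y) L)) t) :
    ∃ L', t = lams a (RangeH.apps (Tm.var y) L') ∧ List.Forall₂ Pars L L' := by
  induction h with
  | refl => exact ⟨L, rfl, List.forall₂_same.2 fun _ _ => .refl⟩
  | tail _ h ih =>
    obtain ⟨L', rfl, hL⟩ := ih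
    obtain ⟨L'', rfl, hL'⟩ := h.of_lams_apps_var
    exact ⟨L'', rfl, forall₂_comp (fun _ _ _ h1 h2 => h1.tail h2) hL hL'⟩

theorem Par.freeBelow {t u : Tm} (h : Par t u) {d : ℕ} (ht : t.FreeBelow d) : u.FreeBelow d := by
  induction h generalizing d with
  | var => exact ht
  | app _ _ hs hu => exact ⟨hs ht.1, hu ht.2⟩
  | lam _ ih => exact ih (d := d + 1) ht
  | red _ _ hp hq =>
    exact (Beta.red _ _).freeBelow (d := d) ⟨hp (d := d + 1) ht.1, hq ht.2⟩
  | om =>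
    have : omega.Closed := by simp [omega, Tm.Closed, Tm.FreeBelow]
    exact this.freeBelow d

theorem Pars.closed {t u : Tm} (h : Pars t u) (ht : t.Closed) : u.Closed := by
  induction h with
  | refl => exact ht
  | tail _ h ih => exact h.freeBelow ih

/-! ### Expanders -/

/-- Let `J` be the fixed point of the closed term `G`, let `κ i` be a list of closed terms and write
`Jᵢ` for `apps J (κ i)`. This says that head reduction takes `G J (κ i) n u` to
`λy₁…λyₛ. u (Jᵢ₊₁ n y₁) … (Jᵢ₊₁ n yₛ)`, where `s = h i`; here variables stand for `J`, `n` and `u`.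
So `Jᵢ n u` is an infinite eta-expansion of `u` that never forgets `n` and never uses it. -/
structure IsExpander (h : ℕ → ℕ) (G : Tm) (κ : ℕ → List Tm) : Prop where
  closed : G.Closed
  closed_index : ∀ i, ∀ t ∈ κ i, t.Closed
  pos : ∀ i, 1 ≤ h (i + 1)
  unfold : ∀ i, HDs (apps G (var 2 :: (κ i ++ [var 1, var 0])))
    (lams (h i) (apps (var (0 + h i)) ((List.range (h i)).map fun j =>
      apps (var (2 + h i)) (κ (i + 1) ++ [var (1 + h i), var (h i - 1 - j)]))))

/-- The term `λz. z (Y z)`, to which the fixed point operator `Y` reduces. -/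
def turingUnrolled : Tm := lam (app (var 0) (app turing (var 0)))

/-- The term `Jᵢ cₙ`, up to reductions that leave its fixed point operator alone. The subterm `cₙ`
can be read off from such a term. -/
def Exact (G : Tm) (κ : ℕ → List Tm) (n i : ℕ) (K : Tm) : Prop :=
  ∃ g ks, Pars G g ∧ List.Forall₂ Pars (κ i) ks ∧ K = app (apps turing (g :: ks)) (church n)

/-- Like `Exact`, but the fixed point operator may have been unrolled once. -/
def Near (G : Tm) (κ : ℕ → List Tm) (n i : ℕ) (K : Tm) : Prop :=
  ∃ T g ks, (T = turing ∨ T = turingUnrolled) ∧ Pars G g ∧ List.Forall₂ Pars (κ i) ks ∧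
    K = app (apps T (g :: ks)) (church n)

theorem turing_closed : turing.Closed := by
  simp [turing, Tm.Closed, Tm.FreeBelow]

theorem turingUnrolled_closed : turingUnrolled.Closed := by
  simp [turingUnrolled, turing, Tm.Closed, Tm.FreeBelow]

theorem wh_turing : WH turing turingUnrolled := WH.red _ _

theorem wh_turingUnrolled (g : Tm) : WH (app turingUnrolled g) (app g (app turing g)) :=
  WH.red _ _

theorem Par.of_turing {t : Tm} (h : Par turing t) : t = turing ∨ t = turingUnrolled := by
  have hbody : ∀ {u}, Par (Tm.lam (Tm.app (Tm.var 0)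
      (Tm.app (Tm.app (Tm.var 1) (Tm.var 1)) (Tm.var 0)))) u →
      u = Tm.lam (Tm.app (Tm.var 0) (Tm.app (Tm.app (Tm.var 1) (Tm.var 1)) (Tm.var 0))) := by
    intro u hu
    obtain ⟨v, rfl, hv⟩ := Par.of_lams_apps_var (a := 1) (y := 0)
      (L := [Tm.app (Tm.app (Tm.var 1) (Tm.var 1)) (Tm.var 0)]) hu
    cases hv with
    | cons h1 h2 =>
      cases h2
      obtain ⟨w, rfl, hw⟩ := Par.of_lams_apps_var (a := 0) (y := 1) (L := [Tm.var 1, Tm.var 0]) h1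
      cases hw with
      | cons h3 h4 =>
        cases h4 with
        | cons h5 h6 =>
          cases h6
          rw [h3.of_var, h5.of_var]
          rfl
  have hsol : Solvable turing :=
    (Hn.step wh_turing (Hn.lam (Hn.neutral (t := Tm.app (Tm.var 0) _) trivial))).solvable
  have hw : Solvable (Tm.lam (Tm.lam (Tm.app (Tm.var 0)
      (Tm.app (Tm.app (Tm.var 1) (Tm.var 1)) (Tm.var 0))))) :=
    (Hn.lam (Hn.lam (Hn.neutral (t := Tm.app (Tm.var 0) _) trivial))).solvable
  cases h with
  | app h1 h2 =>
    obtain ⟨u, rfl, hu⟩ := h1.of_lam hw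
    obtain ⟨v, rfl, hv⟩ := h2.of_lam hw
    rw [hbody hu, hbody hv]
    exact Or.inl rfl
  | red h1 h2 =>
    obtain ⟨v, rfl, hv⟩ := h2.of_lam hw
    rw [hbody h1, hbody hv]
    exact Or.inr rfl
  | om h => exact absurd hsol h

section

variable {h : ℕ → ℕ} {G : Tm} {κ : ℕ → List Tm} {n i : ℕ} {K : Tm}

theorem Exact.near (hK : Exact G κ n i K) : Near G κ n i K := by
  obtain ⟨g, ks, h1, h2, rfl⟩ := hK
  exact ⟨turing, g, ks, Or.inl rfl, h1, h2, rfl⟩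

theorem exact_self (G : Tm) (κ : ℕ → List Tm) (n i : ℕ) :
    Exact G κ n i (app (apps turing (G :: κ i)) (church n)) :=
  ⟨G, κ i, .refl, List.forall₂_same.2 fun _ _ => .refl, rfl⟩

theorem closed_of_forall₂_pars {L L' : List Tm} (hL : List.Forall₂ Pars L L')
    (hc : ∀ t ∈ L, t.Closed) : ∀ t ∈ L', t.Closed := by
  induction hL with
  | nil => simp
  | cons h1 _ ih =>
    intro t ht
    rcases List.mem_cons.1 ht with rfl | ht
    · exact h1.closed (hc _ (by simp))
    · exact ih (fun t ht => hc t (by simp [ht])) t ht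

theorem Near.closed (hJ : IsExpander h G κ) (hK : Near G κ n i K) : K.Closed := by
  obtain ⟨T, g, ks, hT, h1, h2, rfl⟩ := hK
  refine ⟨apps_freeBelow.2 ⟨?_, fun t ht => ?_⟩, church_closed n⟩
  · rcases hT with rfl | rfl
    · exact turing_closed
    · exact turingUnrolled_closed
  · rcases List.mem_cons.1 ht with rfl | ht
    · exact h1.closed hJ.closed
    · exact closed_of_forall₂_pars h2 (hJ.closed_index i) t ht

theorem Exact.par (hK : Exact G κ n i K) (hs : Solvable K) {K' : Tm} (hp : Par K K') :
    Near G κ n i K' := by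
  obtain ⟨g, ks, h1, h2, rfl⟩ := hK
  have hlam : ∀ (L : List Tm) p, apps turing L ≠ lam p := by
    intro L
    induction L using List.reverseRecOn with
    | nil => exact fun p hp => Tm.noConfusion hp
    | append_singleton L u _ => rw [apps_concat]; exact fun p hp => Tm.noConfusion hp
  obtain ⟨a, c, rfl, ha, hc⟩ := hp.of_app hs (hlam _)
  obtain ⟨T, L, rfl, hT, hL⟩ := ha.of_apps hs.of_app fun p hp => Tm.noConfusion hp
  cases hL with
  | @cons _ g' _ ks' hg hks =>
    rw [hc.of_church]
    exact ⟨T, g', ks', hT.of_turing, h1.tail hg,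
      forall₂_comp (fun _ _ _ h1 h2 => h1.tail h2) h2 hks, rfl⟩

/-- The unfolding of a wrapper for variables in the place of its arguments. All the new wrappers
have the fixed point operator intact again, since the variable in its place cannot be touched. -/
theorem IsExpander.unfold_pars (hJ : IsExpander h G κ) {g : Tm} {ks : List Tm} (hg : Pars G g)
    (hks : List.Forall₂ Pars (κ i) ks) :
    ∃ L, List.Forall₂ (fun j x => ∃ ks', List.Forall₂ Pars (κ (i + 1)) ks' ∧
        x = apps (var (2 + h i)) (ks' ++ [var (1 + h i), var (h i - 1 - j)])) (List.range (h i)) L ∧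
      HDs (apps g (var 2 :: (ks ++ [var 1, var 0]))) (lams (h i) (apps (var (0 + h i)) L)) := by
  have hp : Pars (apps G (var 2 :: (κ i ++ [var 1, var 0])))
      (apps g (var 2 :: (ks ++ [var 1, var 0]))) :=
    hg.apps (.cons .refl (List.rel_append hks (List.forall₂_same.2 fun _ _ => .refl)))
  obtain ⟨t, h1, h2⟩ := hp.hds (hJ.unfold i) (hn_lams_apps_var _ _ _).solvable
  obtain ⟨L, rfl, hL⟩ := h1.of_lams_apps_var
  refine ⟨L, ?_, h2⟩
  rw [List.forall₂_map_left_iff] at hL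
  refine hL.imp fun j x hx => ?_
  obtain ⟨L', rfl, hL'⟩ := Pars.of_lams_apps_var (a := 0) hx
  have hv : ∀ {y : ℕ} {u : Tm}, Pars (var y) u → u = var y := by
    intro y u hu
    induction hu with
    | refl => rfl
    | tail _ h ih => subst ih; exact h.of_var
  obtain ⟨ks', rest, rfl, h3, h4⟩ := forall₂_append_left hL'
  cases h4 with
  | cons h5 h6 =>
    cases h6 with
    | cons h7 h8 =>
      cases h8
      rw [hv h5, hv h7]
      exact ⟨ks', h3, rfl⟩

theorem map_subst_of_closed {L : List Tm} (hL : ∀ t ∈ L, t.Closed) (s : ℕ → Tm) :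
    L.map (Tm.subst s) = L := by
  conv_rhs => rw [← List.map_id L]
  exact List.map_congr_left fun t ht => (hL t ht).subst s

theorem Near.run (hJ : IsExpander h G κ) (hK : Near G κ n i K) (r : Tm) :
    ∃ g L, Pars G g ∧
      List.Forall₂ (fun j x => ∃ ks', List.Forall₂ Pars (κ (i + 1)) ks' ∧
        x = apps (var (2 + h i)) (ks' ++ [var (1 + h i), var (h i - 1 - j)])) (List.range (h i)) L ∧
      HDs (app K r) ((lams (h i) (apps (var (0 + h i)) L)).subst
        (scons r (scons (church n) (scons (app turing g) var)))) := by
  obtain ⟨T, g, ks, hT, hg, hks, rfl⟩ := hK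
  obtain ⟨L, hL, hrun⟩ := hJ.unfold_pars hg hks
  have hgc : g.Closed := hg.closed hJ.closed
  have hkc := closed_of_forall₂_pars hks (hJ.closed_index i)
  set s : ℕ → Tm := scons r (scons (church n) (scons (app turing g) var)) with hs
  have hst : WHs (app (apps T (g :: ks)) (church n))
      (app (apps g (app turing g :: ks)) (church n)) := by
    have h1 : WHs (app T g) (app g (app turing g)) := by
      rcases hT with rfl | rfl
      · exact .head (wh_turing.appL g) (.single (wh_turingUnrolled g))
      · exact .single (wh_turingUnrolled g)
    exact (h1.apps ks).appL _
  have hrun' := hrun.subst s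
  have e1 : (apps g (var 2 :: (ks ++ [var 1, var 0]))).subst s =
      app (app (apps g (app turing g :: ks)) (church n)) r := by
    rw [apps_subst, hgc.subst]
    simp only [List.map_cons, List.map_append, map_subst_of_closed hkc, List.map_nil]
    rw [apps_cons, apps_append]
    rfl
  rw [e1] at hrun'
  exact ⟨g, L, hg, hL, (hst.appL r).hds.trans hrun'⟩

/-- A wrapper in front of as many arguments as it can take: the new wrappers go to these
arguments. -/
theorem Near.unfold (hJ : IsExpander h G κ) (hK : Near G κ n i K) (r : Tm) {Z : List Tm}
    (hZ : Z.length = h i) :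
    ∃ Z', List.Forall₂ (fun z z' => ∃ K', Exact G κ n (i + 1) K' ∧ z' = app K' z) Z Z' ∧
      ∀ rest v, Arg (apps r (Z' ++ rest)) v → Arg (apps (app K r) (Z ++ rest)) v := by
  obtain ⟨g, L, hg, hL, hrun⟩ := hK.run hJ r
  set s : ℕ → Tm := scons r (scons (church n) (scons (app turing g) var)) with hs
  refine ⟨L.map (Tm.subst (instList Z s)), ?_, fun rest v hv => ?_⟩
  · rw [List.forall₂_map_right_iff]
    rw [List.forall₂_iff_get] at hL ⊢
    obtain ⟨hlen, hget⟩ := hL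
    rw [List.length_range] at hlen
    refine ⟨by omega, fun j h1 h2 => ?_⟩
    obtain ⟨ks', hks', hx⟩ := hget j (by simp; omega) h2
    refine ⟨_, ⟨g, ks', hg, hks', rfl⟩, ?_⟩
    rw [hx, apps_subst]
    simp only [List.get_eq_getElem, List.getElem_range, List.map_append, List.map_cons,
      List.map_nil, Tm.subst,
      map_subst_of_closed (closed_of_forall₂_pars hks' (hJ.closed_index (i + 1)))]
    rw [← hZ, instList_add, instList_add, instList_get Z s j h1, apps_append]
    rfl
  · refine Arg.hds_apps hrun ?_
    rw [apps_append, ← hZ]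
    refine Arg.whs ((whs_lams_apps Z _ s).apps rest) ?_
    rw [apps_subst]
    simp only [Tm.subst]
    rw [instList_add, ← apps_append]
    exact hv

/-- With fewer arguments than it can take, a wrapper reduces to an abstraction. -/
theorem Near.whs_lam (hJ : IsExpander h G κ) (hK : Near G κ n i K) (r : Tm) {Z : List Tm}
    (hZ : Z.length < h i) : ∃ p, WHs (apps (app K r) Z) (lam p) := by
  obtain ⟨g, L, hg, hL, hrun⟩ := hK.run hJ r
  exact whs_lam_of_hds_apps hrun (whs_lams_apps_lam Z hZ _ _)

end

/-! ### Terms with inserted wrappers -/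

/-- `Ex S M M'`: the term `M'` arises from `M` by putting wrappers from `S` in front of some
subterms. -/
inductive Ex (S : Tm → Prop) : Tm → Tm → Prop
  | var (y : ℕ) : Ex S (var y) (var y)
  | app {p p' q q' : Tm} : Ex S p p' → Ex S q q' → Ex S (app p q) (app p' q')
  | lam {p p' : Tm} : Ex S p p' → Ex S (lam p) (lam p')
  | wrap {K m m' : Tm} : S K → Ex S m m' → Ex S m (app K m')

theorem Ex.refl (S : Tm → Prop) (t : Tm) : Ex S t t := by
  induction t with
  | var n => exact Ex.var n
  | app s t hs ht => exact Ex.app hs ht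
  | lam t ht => exact Ex.lam ht

theorem Ex.mono {S S' : Tm → Prop} (hS : ∀ K, S K → S' K) {m m' : Tm} (h : Ex S m m') :
    Ex S' m m' := by
  induction h with
  | var y => exact Ex.var y
  | app _ _ hp hq => exact Ex.app hp hq
  | lam _ hp => exact Ex.lam hp
  | wrap hK _ hm => exact Ex.wrap (hS _ hK) hm

theorem Ex.rename {S : Tm → Prop} (hS : ∀ K, S K → K.Closed) {m m' : Tm} (h : Ex S m m')
    (r : ℕ → ℕ) : Ex S (m.rename r) (m'.rename r) := by
  induction h generalizing r with
  | var y => exact Ex.var _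
  | app _ _ hp hq => exact Ex.app (hp r) (hq r)
  | lam _ hp => exact Ex.lam (hp _)
  | wrap hK _ hm =>
    refine Ex.wrap ?_ (hm r)
    rwa [Tm.Closed.rename (hS _ hK)]

theorem Ex.subst {S : Tm → Prop} (hS : ∀ K, S K → K.Closed) {m m' : Tm} (h : Ex S m m')
    {s s' : ℕ → Tm} (hs : ∀ i, Ex S (s i) (s' i)) : Ex S (m.subst s) (m'.subst s') := by
  induction h generalizing s s' with
  | var y => exact hs y
  | app _ _ hp hq => exact Ex.app (hp hs) (hq hs)
  | lam _ hp =>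
    refine Ex.lam (hp fun i => ?_)
    cases i with
    | zero => exact Ex.var 0
    | succ i => exact (hs i).rename hS _
  | wrap hK _ hm =>
    refine Ex.wrap ?_ (hm hs)
    rwa [Tm.Closed.subst (hS _ hK)]

theorem Ex.contract {S : Tm → Prop} (hS : ∀ K, S K → K.Closed) {p p' q q' : Tm} (h : Ex S p p')
    (hq : Ex S q q') : Ex S (p.contract q) (p'.contract q') := by
  rw [contract_eq, contract_eq]
  refine h.subst hS fun i => ?_
  cases i with
  | zero => exact hq
  | succ i => exact Ex.var i

/-- The wrappers of any index for the numeral `cₙ`, with fixed point operators unrolled at most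
once. -/
abbrev AnyNear (G : Tm) (κ : ℕ → List Tm) (n : ℕ) (K : Tm) : Prop := ∃ i, Near G κ n i K

/-- The wrappers of any index for the numeral `cₙ`. -/
abbrev AnyExact (G : Tm) (κ : ℕ → List Tm) (n : ℕ) (K : Tm) : Prop := ∃ i, Exact G κ n i K

/-- A nest of wrappers, at least one, around a variable. The outermost one has an index at which
the arity is positive. -/
def Nest (G : Tm) (κ : ℕ → List Tm) (n : ℕ) (t : Tm) : Prop :=
  ∃ i K y r, Exact G κ n (i + 1) K ∧ Ex (AnyExact G κ n) (var y) r ∧ t = app K r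

/-- The last argument of the head normal form of `t` is a nest of wrappers. -/
def LastNest (G : Tm) (κ : ℕ → List Tm) (n : ℕ) (t : Tm) : Prop :=
  ∃ v, Arg t v ∧ Nest G κ n v

/-- `z'` is `z` or `z` with a wrapper of index `i` in front. -/
def WrapOpt (G : Tm) (κ : ℕ → List Tm) (n i : ℕ) (z z' : Tm) : Prop :=
  z' = z ∨ ∃ K, Exact G κ n i K ∧ z' = app K z

section

variable {h : ℕ → ℕ} {G : Tm} {κ : ℕ → List Tm} {n i : ℕ} {K : Tm}

theorem Exact.closed (hJ : IsExpander h G κ) (hK : Exact G κ n i K) : K.Closed :=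
  hK.near.closed hJ

theorem AnyNear.closed (hJ : IsExpander h G κ) (K : Tm) (hK : AnyNear G κ n K) : K.Closed :=
  hK.elim fun _ hK => hK.closed hJ

theorem AnyExact.closed (hJ : IsExpander h G κ) (K : Tm) (hK : AnyExact G κ n K) : K.Closed :=
  hK.elim fun _ hK => hK.closed hJ

theorem Nest.rename (hJ : IsExpander h G κ) {t : Tm} (ht : Nest G κ n t) (r : ℕ → ℕ) :
    Nest G κ n (t.rename r) := by
  obtain ⟨i, K, y, u, hK, hu, rfl⟩ := ht
  refine ⟨i, K, r y, u.rename r, hK, hu.rename (AnyExact.closed hJ) r, ?_⟩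
  show app (K.rename r) _ = _
  rw [(hK.closed hJ).rename]

theorem Nest.ex {t : Tm} (ht : Nest G κ n t) : ∃ y, Ex (AnyNear G κ n) (var y) t := by
  obtain ⟨i, K, y, u, hK, hu, rfl⟩ := ht
  exact ⟨y, Ex.wrap ⟨_, hK.near⟩ (hu.mono fun _ ⟨j, h⟩ => ⟨j, h.near⟩)⟩

theorem Nest.wrapOpt {t t' : Tm} (ht : Nest G κ n t) (h : WrapOpt G κ n (i + 1) t t') :
    Nest G κ n t' := by
  rcases h with rfl | ⟨K', hK', rfl⟩
  · exact ht
  · obtain ⟨j, K, y, u, hK, hu, rfl⟩ := ht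
    exact ⟨i, K', y, _, hK', Ex.wrap ⟨_, hK⟩ hu, rfl⟩

theorem Ex.wrapOpt {m t t' : Tm} (ht : Ex (AnyNear G κ n) m t) (h : WrapOpt G κ n i t t') :
    Ex (AnyNear G κ n) m t' := by
  rcases h with rfl | ⟨K', hK', rfl⟩
  · exact ht
  · exact Ex.wrap ⟨_, hK'.near⟩ ht

theorem LastNest.wh {t u : Tm} (hw : WH t u) (hu : LastNest G κ n u) : LastNest G κ n t :=
  hu.imp fun _ hv => ⟨Arg.step hw hv.1, hv.2⟩

theorem LastNest.eta {t p : Tm} (hw : WHs t (lam p))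
    (h : LastNest G κ n (app (t.rename Nat.succ) (var 0))) : LastNest G κ n t :=
  h.imp fun _ hv => ⟨Arg.eta hw hv.1, hv.2⟩

/-- Supply a wrapper with as many fresh variables as it can take. -/
theorem Near.saturate (hJ : IsExpander h G κ) (hK : Near G κ n i K) (e : ℕ) (r : Tm) (Z : List Tm)
    (he : Z.length + e = h i) :
    ∃ V : List ℕ, V.length = e ∧
      (LastNest G κ n (apps (app K (r.rename (· + e))) (Z.map (Tm.rename (· + e)) ++ V.map var)) →
        LastNest G κ n (apps (app K r) Z)) := by
  induction e generalizing r Z with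
  | zero =>
    refine ⟨[], rfl, fun H => ?_⟩
    have : Z.map (Tm.rename (· + 0)) = Z := by
      conv_rhs => rw [← List.map_id Z]
      exact List.map_congr_left fun t _ => rename_id t
    rw [this] at H
    rw [show r.rename (· + 0) = r from rename_id r] at H
    simpa using H
  | succ e ih =>
    obtain ⟨p, hp⟩ := hK.whs_lam hJ r (Z := Z) (by omega)
    obtain ⟨V, hV, H⟩ := ih (r.rename Nat.succ) (Z.map (Tm.rename Nat.succ) ++ [var 0])
      (by simp; omega)
    refine ⟨e :: V, by simp [hV], fun h1 => LastNest.eta hp ?_⟩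
    have e1 : (apps (app K r) Z).rename Nat.succ =
        apps (app K (r.rename Nat.succ)) (Z.map (Tm.rename Nat.succ)) := by
      rw [apps_rename]
      show apps (app (K.rename _) _) _ = _
      rw [(hK.closed hJ).rename]
    rw [e1, ← apps_concat]
    refine H ?_
    have e2 : (fun i => Nat.succ i + e) = (· + (e + 1)) := by funext i; simp; omega
    simp only [List.map_append, List.map_map, List.map_cons, List.map_nil, rename_rename,
      List.append_assoc, List.cons_append, List.nil_append, Function.comp_def, e2, Tm.rename,
      Nat.zero_add] at h1 ⊢
    exact h1

/-- A wrapper in front of any number of arguments unfolds. If it can take more than it gets,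
fresh variables come in, which are turned into nests. -/
theorem Near.unfold_any (hJ : IsExpander h G κ) (hK : Near G κ n i K) (r : Tm) (Z : List Tm) :
    ∃ e Z' E, List.Forall₂ (WrapOpt G κ n (i + 1)) (Z.map (Tm.rename (· + e))) Z' ∧
      (∀ x ∈ E, Nest G κ n x) ∧ h i ≤ Z.length + E.length ∧
      (LastNest G κ n (apps (r.rename (· + e)) (Z' ++ E)) → LastNest G κ n (apps (app K r) Z)) := by
  rcases le_or_gt (h i) Z.length with hle | hlt
  · obtain ⟨Z', hZ', H⟩ := hK.unfold hJ r (Z := Z.take (h i)) (by simp [hle])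
    refine ⟨0, Z' ++ Z.drop (h i), [], ?_, by simp, by simpa using hle, ?_⟩
    · have : Z.map (Tm.rename (· + 0)) = Z.take (h i) ++ Z.drop (h i) := by
        rw [List.take_append_drop]
        conv_rhs => rw [← List.map_id Z]
        exact List.map_congr_left fun t _ => rename_id t
      rw [this]
      exact List.rel_append (hZ'.imp fun _ _ h => Or.inr h)
        (List.forall₂_same.2 fun _ _ => Or.inl rfl)
    · rintro ⟨v, hv, hn⟩
      refine ⟨v, ?_, hn⟩
      rw [← List.take_append_drop (h i) Z]
      refine H _ _ ?_
      rw [show r.rename (· + 0) = r from rename_id r, List.append_nil] at hv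
      exact hv
  · obtain ⟨e, he⟩ : ∃ e, Z.length + e = h i := ⟨h i - Z.length, by omega⟩
    obtain ⟨V, hV, H⟩ := hK.saturate hJ e r Z he
    obtain ⟨W, hW, H'⟩ := hK.unfold hJ (r.rename (· + e))
      (Z := Z.map (Tm.rename (· + e)) ++ V.map var) (by simp [hV, he])
    obtain ⟨Z', E, rfl, hZ', hE⟩ := forall₂_append_left hW
    refine ⟨e, Z', E, hZ'.imp fun _ _ h => Or.inr h, ?_, ?_, fun ⟨v, hv, hn⟩ => H ⟨v, ?_, hn⟩⟩
    · intro x hx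
      obtain ⟨z, hz, K', hK', rfl⟩ := exists_of_forall₂_right hE hx
      obtain ⟨y, _, rfl⟩ := List.mem_map.1 hz
      exact ⟨i, K', y, _, hK', Ex.var y, rfl⟩
    · have := hE.length_eq
      simp at this
      omega
    · have := H' [] v (by simpa using hv)
      simpa using this

/-- In front of a nonempty list of nests, the terms with inserted wrappers keep a nest as the
last argument of their head normal form, given that this is so for those that begin with an
abstraction. -/
theorem lastNest_of_lam (hJ : IsExpander h G κ) {t : Tm} {l : ℕ}
    (hlam : ∀ (r : ℕ → ℕ) (p p' : Tm) (Q Q' Y : List Tm), Ex (AnyNear G κ n) p p' →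
      List.Forall₂ (Ex (AnyNear G κ n)) Q Q' → (∀ y ∈ Y, Nest G κ n y) → l + 1 ≤ Y.length →
      t.rename r = apps (lam p) Q → LastNest G κ n (apps (lam p') (Q' ++ Y)))
    {m m' : Tm} (hm : Ex (AnyNear G κ n) m m') (r ρ : ℕ → ℕ) {Q Q' Y : List Tm}
    (hQ : List.Forall₂ (Ex (AnyNear G κ n)) Q Q') (hY : ∀ y ∈ Y, Nest G κ n y)
    (hl : l + 1 ≤ Y.length) (ht : t.rename r = apps (m.rename ρ) Q) :
    LastNest G κ n (apps (m'.rename ρ) (Q' ++ Y)) := by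
  induction hm generalizing r ρ Q Q' Y with
  | var y =>
    rcases List.eq_nil_or_concat Y with rfl | ⟨Y, z, rfl⟩
    · simp at hl
    · rw [List.concat_eq_append, ← List.append_assoc, apps_concat]
      exact ⟨z, Arg.arg (neutral_apps.2 trivial), hY z (by simp)⟩
  | app hp hq ihp _ =>
    exact ihp r ρ (.cons (hq.rename (AnyNear.closed hJ) ρ) hQ) hY hl ht
  | lam hp _ =>
    exact hlam r _ _ Q Q' Y (hp.rename (AnyNear.closed hJ) _) hQ hY hl ht
  | @wrap K m m' hK hm ih =>
    obtain ⟨i, hK⟩ := hK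
    show LastNest G κ n (apps (app (K.rename ρ) (m'.rename ρ)) (Q' ++ Y))
    rw [(hK.closed hJ).rename]
    obtain ⟨e, Z', E, hZ', hE, -, H⟩ := hK.unfold_any hJ (m'.rename ρ) (Q' ++ Y)
    refine H ?_
    rw [List.map_append] at hZ'
    obtain ⟨Q'', Y', rfl, hQ'', hY'⟩ := forall₂_append_left hZ'
    rw [List.append_assoc, rename_rename]
    refine ih (fun i => r i + e) (fun i => ρ i + e) (Q := Q.map (Tm.rename (· + e))) ?_ ?_ ?_ ?_
    · refine forall₂_comp (R := Ex (AnyNear G κ n)) (S := WrapOpt G κ n (i + 1))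
        (fun _ _ _ h1 h2 => h1.wrapOpt h2) ?_ hQ''
      rw [List.forall₂_map_left_iff, List.forall₂_map_right_iff]
      exact hQ.imp fun _ _ h => h.rename (AnyNear.closed hJ) _
    · intro y hy
      rcases List.mem_append.1 hy with hy | hy
      · obtain ⟨z, hz, hzy⟩ : ∃ z, Nest G κ n z ∧ WrapOpt G κ n (i + 1) z y := by
          obtain ⟨z, hz, hzy⟩ := exists_of_forall₂_right hY' hy
          obtain ⟨x, hx, rfl⟩ := List.mem_map.1 hz
          exact ⟨_, (hY x hx).rename hJ _, hzy⟩
        exact hz.wrapOpt hzy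
      · exact hE y hy
    · have := hY'.length_eq
      simp only [List.length_map, List.length_append] at this ⊢
      omega
    · rw [← rename_rename t r (· + e), ht, apps_rename, rename_rename]

/-- Insert wrappers into a head normalizing term and supply more nests than the head normal form
has abstractions. Then some nest is left as the last argument of the head normal form. -/
theorem lastNest_apps (hJ : IsExpander h G κ) {l : ℕ} {m m' : Tm} {Q Q' Y : List Tm}
    (hn : Hn l (apps m Q)) (hm : Ex (AnyNear G κ n) m m')
    (hQ : List.Forall₂ (Ex (AnyNear G κ n)) Q Q') (hY : ∀ y ∈ Y, Nest G κ n y)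
    (hl : l + 1 ≤ Y.length) : LastNest G κ n (apps m' (Q' ++ Y)) := by
  -- Nests take the place of variables, so that the head reduction of `apps m Q` is imitated up to
  -- a renaming which may identify variables.
  have key : ∀ {l : ℕ} {t : Tm}, Hn l t → ∀ (r : ℕ → ℕ) {m m' : Tm} {Q Q' Y : List Tm},
      Ex (AnyNear G κ n) m m' → List.Forall₂ (Ex (AnyNear G κ n)) Q Q' →
      (∀ y ∈ Y, Nest G κ n y) → l + 1 ≤ Y.length → t.rename r = apps m Q →
      LastNest G κ n (apps m' (Q' ++ Y)) := by
    intro l t hn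
    induction hn with
    | neutral hn =>
      intro r m m' Q Q' Y hm hQ hY hl ht
      have := lastNest_of_lam hJ (fun r p p' Q Q' Y _ _ _ _ ht => ?_) hm r id hQ hY hl
        (ht.trans (by rw [show m.rename id = m from rename_id m]))
      · rwa [show m'.rename id = m' from rename_id m'] at this
      · have h1 := hn.subst_var r
        rw [ht, neutral_apps] at h1
        exact h1.elim
    | @lam l t _ ih =>
      intro r m m' Q Q' Y hm hQ hY hl ht
      have := lastNest_of_lam hJ (fun r p p' Q Q' Y hp hQ hY hl ht => ?_) hm r id hQ hY hl
        (ht.trans (by rw [show m.rename id = m from rename_id m]))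
      · rwa [show m'.rename id = m' from rename_id m'] at this
      · cases hQ with
        | cons => exact absurd ht.symm (apps_app_ne_lam _ _ _ _)
        | nil =>
          cases Y with
          | nil => simp at hl
          | cons y Y =>
            obtain ⟨v, hv⟩ := (hY y (by simp)).ex
            refine LastNest.wh (WH.apps (WH.red p' y) Y) ?_
            refine ih (fun i => i.casesOn v r)
              (hp.contract (AnyNear.closed hJ) hv) .nil (fun z hz => hY z (by simp [hz]))
              (by simpa using hl) ?_
            rw [← Tm.lam.inj ht, contract_var_eq_rename, rename_rename]
            refine congrFun (congrArg Tm.rename ?_) t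
            funext i
            cases i <;> rfl
    | @step l t t' hw _ ih =>
      intro r m m' Q Q' Y hm hQ hY hl ht
      have := lastNest_of_lam hJ (fun r p p' Q Q' Y hp hQ hY hl ht => ?_) hm r id hQ hY hl
        (ht.trans (by rw [show m.rename id = m from rename_id m]))
      · rwa [show m'.rename id = m' from rename_id m'] at this
      · have h1 := hw.rename r
        rw [ht] at h1
        cases hQ with
        | nil => cases h1
        | @cons q q' Q Q' hq hQ =>
          refine LastNest.wh (WH.apps (WH.red p' q') (Q' ++ Y)) ?_
          exact ih r (hp.contract (AnyNear.closed hJ) hq) hQ hY hl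
            (h1.det (WH.apps (WH.red p q) Q))
  exact key hn id hm hQ hY hl (rename_id _)

/-- If a further wrapper of large arity is put in front, then it supplies these nests itself. -/
theorem Near.lastNest (hJ : IsExpander h G κ) (hK : Near G κ n i K) {l : ℕ} {m m' : Tm}
    {Q Q' Y : List Tm} (hn : Hn l (apps m Q)) (hm : Ex (AnyNear G κ n) m m')
    (hQ : List.Forall₂ (Ex (AnyNear G κ n)) Q Q') (hY : ∀ y ∈ Y, Nest G κ n y)
    (hl : Q.length + l + 1 ≤ h i) : LastNest G κ n (apps (app K m') (Q' ++ Y)) := by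
  obtain ⟨e, Z', E, hZ', hE, hlen, H⟩ := hK.unfold_any hJ m' (Q' ++ Y)
  refine H ?_
  rw [List.map_append] at hZ'
  obtain ⟨Q'', Y', rfl, hQ'', hY'⟩ := forall₂_append_left hZ'
  rw [List.append_assoc]
  refine lastNest_apps hJ (l := l) (m := m.rename (· + e)) (Q := Q.map (Tm.rename (· + e))) ?_
    (hm.rename (AnyNear.closed hJ) _) ?_ ?_ ?_
  · rw [← apps_rename]
    exact hn.rename _
  · refine forall₂_comp (R := Ex (AnyNear G κ n)) (S := WrapOpt G κ n (i + 1))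
        (fun _ _ _ h1 h2 => h1.wrapOpt h2) ?_ hQ''
    rw [List.forall₂_map_left_iff, List.forall₂_map_right_iff]
    exact hQ.imp fun _ _ h => h.rename (AnyNear.closed hJ) _
  · intro y hy
    rcases List.mem_append.1 hy with hy | hy
    · obtain ⟨z, hz, hzy⟩ := exists_of_forall₂_right hY' hy
      obtain ⟨x, hx, rfl⟩ := List.mem_map.1 hz
      exact ((hY x hx).rename hJ _).wrapOpt hzy
    · exact hE y hy
  · have h1 := hY'.length_eq
    have h2 := hQ.length_eq
    simp only [List.length_map, List.length_append] at h1 hlen ⊢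
    omega

/-! ### Numerals that cannot get lost -/

theorem Near.lastNest_var (hJ : IsExpander h G κ) (hK : Near G κ n (i + 1) K) {y : ℕ} {r : Tm}
    (hr : Ex (AnyNear G κ n) (var y) r) : LastNest G κ n (app K r) :=
  hK.lastNest hJ (l := 0) (m := var y) (Q := []) (Y := [])
    (Hn.neutral trivial) hr .nil (by simp)
    (by simpa using hJ.pos i)

theorem Nest.lastNest (hJ : IsExpander h G κ) {t : Tm} (ht : Nest G κ n t) :
    LastNest G κ n t := by
  obtain ⟨i, K, y, r, hK, hr, rfl⟩ := ht
  exact hK.near.lastNest_var hJ (hr.mono fun _ ⟨j, h⟩ => ⟨j, h.near⟩)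

theorem Ex.solvable_of_var (hJ : IsExpander h G κ) {y : ℕ} {r : Tm}
    (hr : Ex (AnyNear G κ n) (Tm.var y) r) : Solvable r := by
  have hnest : Nest G κ n (Tm.app (Tm.app (RangeH.apps turing (G :: κ 1)) (church n)) (Tm.var 0)) :=
    ⟨0, _, 0, _, exact_self G κ n 1, Ex.var 0, rfl⟩
  obtain ⟨v, hv, -⟩ := lastNest_apps hJ (l := 0) (m := Tm.var y) (Q := []) (Y := [_])
    (Hn.neutral trivial) hr .nil
    (by simpa using hnest) (by simp)
  exact (Arg.solvable (t := Tm.app r _) hv).of_app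

theorem Ex.par_of_var (hJ : IsExpander h G κ) {y : ℕ} {r r' : Tm}
    (hr : Ex (AnyExact G κ n) (Tm.var y) r) (hp : Par r r') :
    Ex (AnyNear G κ n) (Tm.var y) r' := by
  generalize hm : Tm.var y = m at hr
  induction hr generalizing r' with
  | var => rw [hp.of_var]; exact Ex.var _
  | app => cases hm
  | lam => cases hm
  | @wrap K m m' hK hr ih =>
    subst hm
    have hs : Solvable (Tm.app K m') := Ex.solvable_of_var (n := n) (y := y) hJ
      ((Ex.wrap hK hr).mono fun _ ⟨j, h⟩ => ⟨j, h.near⟩)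
    obtain ⟨i, hK⟩ := hK
    obtain ⟨K', r'', rfl, hK', hr'⟩ := hp.of_app hs
      (by obtain ⟨g, ks, _, _, rfl⟩ := hK; exact fun p hp => Tm.noConfusion hp)
    exact Ex.wrap ⟨i, hK.par hs.of_app hK'⟩ (ih hr' rfl)

theorem Nest.par (hJ : IsExpander h G κ) {t t' : Tm} (ht : Nest G κ n t) (hp : Par t t') :
    LastNest G κ n t' := by
  obtain ⟨v, hv, -⟩ := ht.lastNest hJ
  have hs := hv.solvable
  obtain ⟨i, K, y, r, hK, hr, rfl⟩ := ht
  obtain ⟨K', r', rfl, hK', hr'⟩ := hp.of_app hs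
    (by obtain ⟨g, ks, _, _, rfl⟩ := hK; exact fun p hp => Tm.noConfusion hp)
  exact (hK.par hs.of_app hK').lastNest_var hJ (hr.par_of_var hJ hr')

/-- After passing `T` times to the last argument of the head normal form one comes to a nest of
wrappers for `cₙ`. -/
def NestAt (G : Tm) (κ : ℕ → List Tm) (n : ℕ) : ℕ → Tm → Prop
  | 0, t => Nest G κ n t
  | T + 1, t => ∃ v, Arg t v ∧ NestAt G κ n T v

theorem NestAt.succ (hJ : IsExpander h G κ) {T : ℕ} {t : Tm} (ht : NestAt G κ n T t) :
    NestAt G κ n (T + 1) t := by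
  induction T generalizing t with
  | zero => exact Nest.lastNest hJ ht
  | succ T ih =>
    obtain ⟨v, hv, hT⟩ := ht
    exact ⟨v, hv, ih hT⟩

theorem NestAt.mono (hJ : IsExpander h G κ) {T T' : ℕ} (hT : T ≤ T') {t : Tm}
    (ht : NestAt G κ n T t) : NestAt G κ n T' t := by
  induction hT with
  | refl => exact ht
  | step _ ih => exact ih.succ hJ

theorem NestAt.par (hJ : IsExpander h G κ) {T : ℕ} {t t' : Tm} (ht : NestAt G κ n T t)
    (hp : Par t t') : ∃ T', NestAt G κ n T' t' := by
  induction T generalizing t t' with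
  | zero => exact ⟨1, Nest.par hJ ht hp⟩
  | succ T ih =>
    obtain ⟨v, hv, hT⟩ := ht
    obtain ⟨v', hv', hp'⟩ := hv.par hp
    obtain ⟨T', hT'⟩ := ih hT hp'
    exact ⟨T' + 1, v', hv', hT'⟩

theorem NestAt.pars (hJ : IsExpander h G κ) {T : ℕ} {t t' : Tm} (ht : NestAt G κ n T t)
    (hp : Pars t t') : ∃ T', NestAt G κ n T' t' := by
  induction hp with
  | refl => exact ⟨T, ht⟩
  | tail _ hp ih =>
    obtain ⟨T', hT'⟩ := ih
    exact hT'.par hJ hp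

theorem NestAt.unique {m T : ℕ} {t : Tm} (ht : NestAt G κ n T t) (ht' : NestAt G κ m T t) :
    n = m := by
  induction T generalizing t with
  | zero =>
    obtain ⟨i, K, y, r, hK, _, rfl⟩ := ht
    obtain ⟨i', K', y', r', hK', _, he⟩ := ht'
    obtain ⟨rfl, -⟩ := Tm.app.inj he
    obtain ⟨g, ks, _, _, rfl⟩ := hK
    obtain ⟨g', ks', _, _, he⟩ := hK'
    exact church_injective (Tm.app.inj he).2
  | succ T ih =>
    obtain ⟨v, hv, hT⟩ := ht
    obtain ⟨v', hv', hT'⟩ := ht'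
    rw [hv.det hv'] at hT
    exact ih hT hT'

/-- Two terms that are equal in the theory and have nests of wrappers as last arguments carry the
same numeral. -/
theorem LastNest.eq_of_eqH (hJ : IsExpander h G κ) {m : ℕ} {t u : Tm} (ht : LastNest G κ n t)
    (hu : LastNest G κ m u) (he : EqH t u) : n = m := by
  obtain ⟨w, h1, h2⟩ := he
  obtain ⟨T, hT⟩ := NestAt.pars hJ (T := 1) (n := n) ht h1.pars
  obtain ⟨T', hT'⟩ := NestAt.pars hJ (T := 1) (n := m) hu h2.pars
  exact (hT.mono hJ (le_max_left T T')).unique (hT'.mono hJ (le_max_right T T'))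

end

/-! ### The two fixed points are expanders -/

theorem expand_subst (h : ℕ) (G : Tm) (s : ℕ → Tm) :
    (expand h G).subst s = expand h (G.subst s) := by
  unfold expand
  rw [lams_subst, apps_subst]
  congr 2
  · exact liftSubN_lt (by omega) s
  · rw [List.map_map]
    refine List.map_congr_left fun i hi => ?_
    have hi : i < h := List.mem_range.1 hi
    simp only [Function.comp_apply, Tm.subst]
    rw [liftSubN_lt (by omega), liftSubN_lt (by omega), subst_rename, rename_subst]
    congr 3
    funext j
    rw [Nat.add_comm j, liftSubN_add]

theorem whs_expand_apps {h : ℕ} (G n u : Tm) {Z : List Tm} (hZ : Z.length = h) :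
    WHs (apps (app (app (expand h G) n) u) Z) (apps u (Z.map (app (app G n)))) := by
  subst hZ
  have h1 := whs_lams_apps (n :: u :: Z) (apps (var Z.length)
    ((List.range Z.length).map fun i => app (app (G.rename (· + (Z.length + 2)))
      (var (Z.length + 1))) (var (Z.length - 1 - i)))) var
  rw [subst_var, apps_subst] at h1
  have e0 : instList (n :: u :: Z) var Z.length = u := by
    have := instList_get (n :: u :: Z) var 1 (by simp)
    simpa using this
  have e1 : instList (n :: u :: Z) var (Z.length + 1) = n := by
    have := instList_get (n :: u :: Z) var 0 (by simp)
    simpa using this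
  have e2 : (((List.range Z.length).map fun i => app (app (G.rename (· + (Z.length + 2)))
      (var (Z.length + 1))) (var (Z.length - 1 - i))).map
        (Tm.subst (instList (n :: u :: Z) var))) = Z.map (app (app G n)) := by
    apply List.ext_getElem
    · simp
    · intro j h1 h2
      have hj : j < Z.length := by simpa using h2
      simp only [List.getElem_map, List.getElem_range, Tm.subst, e1, subst_rename]
      have e3 : instList (n :: u :: Z) var (Z.length - 1 - j) = Z[j] := by
        have := instList_get (n :: u :: Z) var (j + 2) (by simpa using hj)
        have e : (n :: u :: Z).length - 1 - (j + 2) = Z.length - 1 - j := by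
          simp only [List.length_cons]; omega
        rw [e] at this
        simpa using this
      have e4 : (fun i => instList (n :: u :: Z) var (i + (Z.length + 2))) = var := by
        funext i
        exact instList_add (n :: u :: Z) var i
      rw [e3, e4, subst_var]
  rw [e2] at h1
  simp only [Tm.subst, e0] at h1
  exact h1

theorem whs_expand (h : ℕ) (G n u : Tm) :
    WHs (app (app (expand h G) n) u) (lams h (apps (u.rename (· + h))
      ((List.range h).map fun i =>
        app (app (G.rename (· + h)) (n.rename (· + h))) (var (h - 1 - i))))) := by
  have h1 := whs_lams_apps [n, u] (lams h (apps (var h)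
    ((List.range h).map fun i => app (app (G.rename (· + (h + 2))) (var (h + 1)))
      (var (h - 1 - i))))) var
  rw [subst_var, lams_subst, apps_subst] at h1
  have e0 : liftSubN h (instList [n, u] var) h = u.rename (· + h) :=
    liftSubN_add h 0 _
  have e1 : liftSubN h (instList [n, u] var) (h + 1) = n.rename (· + h) :=
    liftSubN_add h 1 _
  have e2 : (((List.range h).map fun i => app (app (G.rename (· + (h + 2))) (var (h + 1)))
      (var (h - 1 - i))).map (Tm.subst (liftSubN h (instList [n, u] var)))) =
      (List.range h).map fun i =>
        app (app (G.rename (· + h)) (n.rename (· + h))) (var (h - 1 - i)) := by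
    rw [List.map_map]
    refine List.map_congr_left fun i hi => ?_
    have hi : i < h := List.mem_range.1 hi
    simp only [Function.comp_apply, Tm.subst]
    rw [e1, liftSubN_lt (by omega), subst_rename, rename_eq_subst G]
    congr 3
    funext j
    rw [show j + (h + 2) = h + (j + 2) by omega, liftSubN_add]
    rfl
  rw [e2] at h1
  simp only [Tm.subst, e0] at h1
  exact h1

theorem lams_freeBelow {n d : ℕ} {t : Tm} : (lams n t).FreeBelow d ↔ t.FreeBelow (n + d) := by
  induction n generalizing d with
  | zero => rw [Nat.zero_add]; rfl
  | succ n ih =>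
    rw [show n + 1 + d = n + (d + 1) by omega, ← ih]
    rfl

theorem expand_freeBelow {h d : ℕ} {G : Tm} (hG : G.FreeBelow d) : (expand h G).FreeBelow d := by
  refine lams_freeBelow.2 (apps_freeBelow.2 ⟨show h < _ by omega, fun u hu => ?_⟩)
  obtain ⟨i, hi, rfl⟩ := List.mem_map.1 hu
  have hi : i < h := List.mem_range.1 hi
  exact ⟨⟨hG.rename fun i hi => by omega, show h + 1 < _ by omega⟩, show h - 1 - i < _ by omega⟩

theorem isExpander_const {p : ℕ} (hp : 1 ≤ p) :
    IsExpander (fun _ => p) (lam (expand p (var 0))) (fun _ => []) where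
  closed := expand_freeBelow (d := 1) (Nat.succ_pos 0)
  closed_index := by simp
  pos := fun _ => hp
  unfold := fun _ => by
    refine WHs.hds (.head (WH.apps (WH.red _ _) [var 1, var 0]) ?_)
    rw [contract_eq, expand_subst]
    have := whs_expand p (var 2) (var 1) (var 0)
    exact this

/-- The term `suc (… (suc c₀))`. -/
def iterSuc : ℕ → Tm
  | 0 => church 0
  | i + 1 => app suc (iterSuc i)

theorem suc_closed : suc.Closed := by
  simp [suc, Tm.Closed, Tm.FreeBelow]

theorem iterSuc_closed (i : ℕ) : (iterSuc i).Closed := by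
  induction i with
  | zero => exact church_closed 0
  | succ i ih => exact ⟨suc_closed, ih⟩

theorem betaStar_suc_church (i : ℕ) : BetaStar (app suc (church i)) (church (i + 1)) := by
  refine .head (Beta.red _ _) ?_
  have h1 : BetaStar (app (app (church i) (var 1)) (var 0)) ((app (var 1))^[i] (var 0)) := by
    have := whs_lams_apps [var 1, var 0] ((app (var 1))^[i] (var 0)) var
    rw [subst_var, subst_iterate_app] at this
    exact this.betaStar
  have h2 := ((BetaStar.refl (var 1)).app h1).lam.lam
  rw [contract_eq]
  have e : ((church i).rename Nat.succ).rename Nat.succ = church i := by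
    rw [(church_closed i).rename, (church_closed i).rename]
  simp only [Tm.subst, liftSub, scons, Tm.rename, e]
  unfold church at h2 ⊢
  rw [Function.iterate_succ_apply']
  exact h2

theorem betaStar_iterSuc (i : ℕ) : BetaStar (iterSuc i) (church i) := by
  induction i with
  | zero => exact BetaStar.refl _
  | succ i ih => exact ((BetaStar.refl suc).app ih).trans (betaStar_suc_church i)

/-- The term `λa.λb.λc. a (b (z (suc k) n c))`. -/
def wrapOp (z k n : Tm) : Tm :=
  lam (lam (lam (app (var 2) (app (var 1)
    (apps (z.rename (· + 3)) [app suc k, n.rename (· + 3), var 0])))))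

theorem wrapOp_rename_succ (z : Tm) {k : Tm} (hk : k.Closed) (n : Tm) :
    (wrapOp z k n).rename Nat.succ = wrapOp (z.rename Nat.succ) k (n.rename Nat.succ) := by
  simp only [wrapOp, Tm.rename, apps_rename, List.map_cons, List.map_nil, rename_rename,
    suc_closed.rename, hk.rename, liftRen]

theorem whs_wrapOp (z : Tm) {k : Tm} (hk : k.Closed) (n a b : Tm) :
    WHs (app (app (wrapOp z k n) a) b) (lam (app (a.rename Nat.succ) (app (b.rename Nat.succ)
      (apps (z.rename Nat.succ) [app suc k, n.rename Nat.succ, var 0])))) := by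
  have h1 := whs_lams_apps [a, b] (lam (app (var 2) (app (var 1)
    (apps (z.rename (· + 3)) [app suc k, n.rename (· + 3), var 0])))) var
  rw [subst_var] at h1
  have e : ∀ t : Tm, (t.rename (· + 3)).subst (liftSub (instList [a, b] var)) =
      t.rename Nat.succ := by
    intro t
    rw [subst_rename, rename_eq_subst]
    rfl
  simp only [Tm.subst, apps_subst, List.map_cons, List.map_nil, e, suc_closed.subst, hk.subst]
    at h1
  exact h1

/-- A term that reduces to `f (… (f x))`, with the preceding operator for `f` and the identity for
`x`. -/
theorem hds_numeral_body {P k : Tm} (hk : k.Closed) (s : ℕ) (z n r : Tm)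
    (hP : St P ((app (var 1))^[s] (var 0))) {σ : ℕ → Tm} (h0 : σ 0 = ident)
    (h1 : σ 1 = wrapOp z k n) :
    HDs (app (P.subst σ) r) (lams s (apps (r.rename (· + s)) ((List.range s).map fun j =>
      apps (z.rename (· + s)) [app suc k, n.rename (· + s), var (s - 1 - j)]))) := by
  induction s generalizing P z n r σ with
  | zero =>
    cases hP with
    | var h =>
      have h2 := (h.subst σ).appL r
      simp only [Tm.subst, h0] at h2
      refine (WHs.hds (h2.tail (WH.red _ _))).trans ?_
      rw [show (r.rename (· + 0)) = r from rename_id r]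
      exact .refl
  | succ s ih =>
    rw [Function.iterate_succ_apply'] at hP
    cases hP with
    | @app _ F P' _ _ h hF hP' =>
      cases hF with
      | var hF =>
        have h2 := WHs.appL ((h.subst σ).trans ((hF.subst σ).appL _)) r
        simp only [Tm.subst, h1] at h2
        refine (WHs.hds (h2.trans (whs_wrapOp z hk n _ r))).trans ?_
        have h3 := ih (z.rename Nat.succ) (n.rename Nat.succ) (app (r.rename Nat.succ)
          (apps (z.rename Nat.succ) [app suc k, n.rename Nat.succ, var 0])) hP'
          (σ := fun i => (σ i).rename Nat.succ) (by rw [h0]; rfl)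
          (by rw [h1, wrapOp_rename_succ z hk])
        rw [← rename_subst] at h3
        refine h3.lam.trans ?_
        have e2 : (fun i => Nat.succ i + s) = (· + (s + 1)) := by funext i; simp; omega
        rw [List.range_succ_eq_map]
        simp only [Tm.rename, rename_rename, e2, List.map_cons,
          suc_closed.rename, hk.rename, List.map_map, Function.comp_def, lams, apps_cons, apps_nil]
        simp only [Nat.zero_add, Nat.add_sub_cancel, Nat.sub_zero, Nat.sub_sub, Nat.succ_eq_one_add]
        exact .refl

theorem isExpander_var {h : ℕ → ℕ} {H : Tm} (hH : H.Closed)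
    (hrep : ∀ n, BetaStar (app H (church n)) (church (h n))) (hpos : ∀ i, 1 ≤ h (i + 1)) :
    IsExpander h (lam (lam (lam (lam (apps H
      [var 2, lam (lam (lam (app (var 2) (app (var 1) (apps (var 6) [app suc (var 5), var 4,
        var 0]))))), ident, var 0]))))) (fun i => [iterSuc i]) where
  closed := by
    have h1 := hH.freeBelow 4
    have h2 := suc_closed.freeBelow 7
    simp [Tm.Closed, Tm.FreeBelow, ident, h1, h2]
  closed_index := by
    intro i t ht
    rw [List.mem_singleton.1 ht]
    exact iterSuc_closed i
  pos := hpos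
  unfold := fun i => by
    have h1 := whs_lams_apps [var 2, iterSuc i, var 1, var 0] (apps H
      [var 2, lam (lam (lam (app (var 2) (app (var 1) (apps (var 6) [app suc (var 5), var 4,
        var 0]))))), ident, var 0]) var
    rw [subst_var, apps_subst, hH.subst] at h1
    have e1 : ((iterSuc i).rename Nat.succ).rename Nat.succ = iterSuc i := by
      rw [(iterSuc_closed i).rename, (iterSuc_closed i).rename]
    have e2 : ([var 2, lam (lam (lam (app (var 2) (app (var 1) (apps (var 6) [app suc (var 5),
        var 4, var 0]))))), ident, var 0].map
          (Tm.subst (instList [var 2, iterSuc i, var 1, var 0] var))) =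
        [iterSuc i, wrapOp (var 2) (iterSuc i) (var 1), ident, var 0] := by
      have e3 := (iterSuc_closed i).rename Nat.succ
      simp [Tm.subst, instList, scons, liftSub, wrapOp, Tm.rename, suc_closed.subst, ident, e3]
    rw [e2] at h1
    refine h1.hds.trans ?_
    have h2 : BetaStar (app H (iterSuc i)) (church (h i)) :=
      ((BetaStar.refl H).app (betaStar_iterSuc i)).trans (hrep i)
    cases h2.st with
    | @lam _ P _ hw hP =>
      cases hP with
      | @lam _ P' _ hw' hP' =>
        have h3 := hw.apps [wrapOp (var 2) (iterSuc i) (var 1), ident, var 0]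
        have h4 := h3.tail (WH.apps (WH.red _ _) [ident, var 0])
        rw [contract_eq] at h4
        have h5 := (h4.trans ((hw'.subst _).apps [ident, var 0])).tail
          (WH.apps (WH.red _ _) [var 0])
        rw [liftSub_contract] at h5
        refine (WHs.hds h5).trans ?_
        have h6 := hds_numeral_body (iterSuc_closed i) (h i) (var 2) (var 1) (var 0) hP'
          (σ := scons ident (scons (wrapOp (var 2) (iterSuc i) (var 1)) var)) rfl rfl
        exact h6

/-! ### Residues of an occurrence -/

/-- `AllOcc Q d L t`: in the term `apps t L` below `d` binders, each occurrence of the mark (the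
free variable number `1`, index `d + 1`) in `t` has a depth and a list of arguments with the
property `Q`. -/
def AllOcc (Q : ℕ → List Tm → Prop) : ℕ → List Tm → Tm → Prop
  | d, L, var i => i = d + 1 → Q d L
  | d, L, app s t => AllOcc Q d (t :: L) s ∧ AllOcc Q d [] t
  | d, _, lam t => AllOcc Q (d + 1) [] t

/-- The properties of a depth and a list of arguments that are kept when the arguments are reduced,
when further arguments come in, and when substitution takes place elsewhere. -/
structure IsStable (Q : ℕ → List Tm → Prop) : Prop where
  beta : ∀ {d L L'}, Q d L → List.Forall₂ BetaStar L L' → Q d L'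
  append : ∀ {d L} (L'), Q d L → Q d (L ++ L')
  subst : ∀ {e d L} {s : ℕ → Tm}, Q e L → s e = var d → s (e + 1) = var (d + 1) →
    Q d (L.map (Tm.subst s))

/-- The list `L'` begins with reducts of the members of `L`. -/
def Extends (L L' : List Tm) : Prop := ∃ M N, L' = M ++ N ∧ List.Forall₂ BetaStar L M

theorem Extends.refl (L : List Tm) : Extends L L :=
  ⟨L, [], by simp, List.forall₂_same.2 fun _ _ => BetaStar.refl _⟩

theorem Extends.nil (L : List Tm) : Extends [] L := ⟨[], L, rfl, .nil⟩

theorem Extends.cons {t t' : Tm} (ht : BetaStar t t') {L L' : List Tm} (h : Extends L L') :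
    Extends (t :: L) (t' :: L') := by
  obtain ⟨M, N, rfl, hM⟩ := h
  exact ⟨t' :: M, N, rfl, .cons ht hM⟩

theorem IsStable.extends {Q : ℕ → List Tm → Prop} (hQ : IsStable Q) {d : ℕ} {L L' : List Tm}
    (h : Q d L) (hL : Extends L L') : Q d L' := by
  obtain ⟨M, N, rfl, hM⟩ := hL
  exact hQ.append N (hQ.beta h hM)

theorem AllOcc.extends {Q : ℕ → List Tm → Prop} (hQ : IsStable Q) {d : ℕ} {L L' : List Tm}
    {t : Tm} (h : AllOcc Q d L t) (hL : Extends L L') : AllOcc Q d L' t := by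
  induction t generalizing L L' with
  | var i => exact fun hi => hQ.extends (h hi) hL
  | app s t hs _ => exact ⟨hs h.1 (hL.cons (BetaStar.refl _)), h.2⟩
  | lam t _ => exact h

theorem AllOcc.rename {Q : ℕ → List Tm → Prop} (hQ : IsStable Q) {d e : ℕ} {L : List Tm} {t : Tm}
    (h : AllOcc Q d L t) {r : ℕ → ℕ} (h0 : r d = e) (h1 : r (d + 1) = e + 1)
    (hr : ∀ i, r i = e + 1 → i = d + 1) : AllOcc Q e (L.map (Tm.rename r)) (t.rename r) := by
  induction t generalizing L d e r with
  | var i =>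
    intro hi
    have e1 : L.map (Tm.rename r) = L.map (Tm.subst fun i => var (r i)) :=
      List.map_congr_left fun t _ => rename_eq_subst t r
    rw [e1]
    exact hQ.subst (h (hr i hi)) (by rw [h0]) (by rw [h1])
  | app s t hs ht => exact ⟨hs h.1 h0 h1 hr, ht h.2 h0 h1 hr⟩
  | lam t ht =>
    refine ht (d := d + 1) (e := e + 1) h (by simp [liftRen, h0]) (by simp [liftRen, h1])
      fun i hi => ?_
    cases i with
    | zero => simp [liftRen] at hi
    | succ i => rw [hr i (by simpa [liftRen] using hi)]

theorem AllOcc.subst {Q : ℕ → List Tm → Prop} (hQ : IsStable Q) {d e : ℕ} {L L' : List Tm}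
    {t : Tm} (h : AllOcc Q e L t) {s : ℕ → Tm} (h0 : s e = Tm.var d)
    (h1 : s (e + 1) = Tm.var (d + 1)) (hs : ∀ i ≠ e + 1, AllOcc Q d [] (s i))
    (hL : Extends (L.map (Tm.subst s)) L') : AllOcc Q d L' (t.subst s) := by
  induction t generalizing L L' d e s with
  | var i =>
    by_cases hi : i = e + 1
    · subst hi
      show AllOcc Q d L' (s (e + 1))
      rw [h1]
      exact fun _ => hQ.extends (hQ.subst (h rfl) h0 h1) hL
    · exact (hs i hi).extends hQ (Extends.nil L')
  | app u t hu ht =>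
    exact ⟨hu h.1 h0 h1 hs (hL.cons (BetaStar.refl _)), ht h.2 h0 h1 hs (Extends.refl _)⟩
  | lam t ht =>
    refine ht (d := d + 1) (e := e + 1) h (by simp [liftSub, h0, Tm.rename])
      (by simp [liftSub, h1, Tm.rename]) (fun i hi => ?_) (Extends.refl _)
    cases i with
    | zero => exact fun h => absurd h (by omega)
    | succ i =>
      exact (hs i (by omega)).rename hQ rfl rfl fun j hj => Nat.succ.inj hj

theorem AllOcc.beta {Q : ℕ → List Tm → Prop} (hQ : IsStable Q) {d : ℕ} {L : List Tm}
    {t u : Tm} (h : AllOcc Q d L t) (hb : Beta t u) : AllOcc Q d L u := by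
  induction hb generalizing d L with
  | red t u =>
    rw [contract_eq]
    refine AllOcc.subst hQ (e := d + 1) (L := []) h.1 rfl rfl (fun i hi => ?_) (Extends.nil L)
    cases i with
    | zero => exact h.2
    | succ i => exact fun hi' => absurd hi' (by omega)
  | appL t _ ih => exact ⟨ih h.1, h.2⟩
  | appR s hb ih =>
    exact ⟨h.1.extends hQ ((Extends.refl L).cons (.single hb)), ih h.2⟩
  | lam _ ih => exact ih (d := d + 1) h

theorem AllOcc.betaStar {Q : ℕ → List Tm → Prop} (hQ : IsStable Q) {d : ℕ} {L : List Tm}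
    {t u : Tm} (h : AllOcc Q d L t) (hb : BetaStar t u) : AllOcc Q d L u := by
  induction hb with
  | refl => exact h
  | tail _ hb ih => exact ih.beta hQ hb

theorem AllOcc.of_freeBelow (Q : ℕ → List Tm → Prop) {d : ℕ} (L : List Tm) {t : Tm}
    (ht : t.FreeBelow (d + 1)) : AllOcc Q d L t := by
  induction t generalizing d L with
  | var i => exact fun hi => absurd (show i < d + 1 from ht) (by omega)
  | app s t hs ht' => exact ⟨hs _ ht.1, ht' _ ht.2⟩
  | lam t ih => exact ih (d := d + 1) _ ht

theorem AllOcc.of_fill {Q : ℕ → List Tm → Prop} (C : Ctx) {t : Tm}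
    (h : AllOcc Q 0 [] (Ctx.fill C t)) : AllOcc Q (Ctx.depth C) (Ctx.args C) t := by
  induction C generalizing t with
  | nil => exact h
  | cons f C ih =>
    have := ih h
    cases f with
    | lam => exact this
    | fn u => exact this.1
    | arg u => exact this.2

theorem fill_freeBelow (C : Ctx) {t : Tm} {b : ℕ} (h : (Ctx.fill C t).FreeBelow b) :
    t.FreeBelow (Ctx.depth C + b) ∧ ∀ u ∈ Ctx.args C, u.FreeBelow (Ctx.depth C + b) := by
  induction C generalizing t with
  | nil => exact ⟨by simpa [Ctx.fill, Ctx.depth] using h, by simp [Ctx.args]⟩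
  | cons f C ih =>
    obtain ⟨h1, h2⟩ := ih h
    cases f with
    | lam =>
      refine ⟨?_, by simp [Ctx.args]⟩
      show t.FreeBelow (Ctx.depth C + 1 + b)
      rw [Nat.add_right_comm]
      exact h1
    | fn u =>
      refine ⟨h1.1, fun v hv => ?_⟩
      rcases List.mem_cons.1 hv with rfl | hv
      · exact h1.2
      · exact h2 v hv
    | arg u => exact ⟨h1.2, by simp [Ctx.args]⟩

theorem AllOcc.fill {Q : ℕ → List Tm → Prop} (C : Ctx) {t t' : Tm}
    (hC : (Ctx.fill C t').FreeBelow 1) (h : AllOcc Q (Ctx.depth C) (Ctx.args C) t) :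
    AllOcc Q 0 [] (Ctx.fill C t) := by
  induction C generalizing t t' with
  | nil => exact h
  | cons f C ih =>
    have h1 := (fill_freeBelow C hC).1
    cases f with
    | lam => exact ih hC h
    | fn u => exact ih hC ⟨h, AllOcc.of_freeBelow Q _ h1.2⟩
    | arg u => exact ih hC ⟨AllOcc.of_freeBelow Q _ h1.1, h⟩

theorem depth_rename (r : ℕ → ℕ) (C : Ctx) : Ctx.depth (Ctx.rename r C) = Ctx.depth C := by
  induction C with
  | nil => rfl
  | cons f C ih =>
    cases f with
    | lam => exact congrArg (· + 1) ih
    | fn u => exact ih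
    | arg u => exact ih

theorem args_rename (r : ℕ → ℕ) (C : Ctx) :
    Ctx.args (Ctx.rename r C) = (Ctx.args C).map (Tm.rename (liftRenN (Ctx.depth C) r)) := by
  induction C with
  | nil => rfl
  | cons f C ih =>
    cases f with
    | lam => rfl
    | fn u => exact congrArg _ ih
    | arg u => rfl

theorem liftRenN_lt {d i : ℕ} (hi : i < d) (r : ℕ → ℕ) : liftRenN d r i = i := by
  induction d generalizing i with
  | zero => omega
  | succ d ih =>
    cases i with
    | zero => rfl
    | succ i => exact congrArg (· + 1) (ih (by omega))

theorem liftRenN_add (d i : ℕ) (r : ℕ → ℕ) : liftRenN d r (d + i) = d + r i := by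
  induction d with
  | zero => simp [liftRenN]
  | succ d ih =>
    rw [Nat.succ_add]
    show liftRenN d r (d + i) + 1 = _
    rw [ih]
    omega

/-- Below `d` binders, put the closed term `A` both for `x` and for the mark. -/
def fillMark (A : Tm) (d : ℕ) : ℕ → Tm := fun i => if i = d ∨ i = d + 1 then A else var i

theorem fillMark_unmark (A : Tm) (d i : ℕ) :
    fillMark A d (liftRenN d unmark i) = fillMark A d i := by
  rcases lt_or_ge i d with h | h
  · rw [liftRenN_lt h]
  · obtain ⟨j, rfl⟩ := Nat.exists_eq_add_of_le h
    rw [liftRenN_add]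
    by_cases hj : j = 1
    · subst hj
      simp [unmark, fillMark]
    · simp [unmark, hj]

/-- `ArgsFrom A d₀ U d V`: the list `V[A]` arises from `U[A]` by a substitution for the bound
variables, by reduction, and by adding further arguments. -/
def ArgsFrom (A : Tm) (d₀ : ℕ) (U : List Tm) (d : ℕ) (V : List Tm) : Prop :=
  ∃ (τ : ℕ → Tm) (E : List Tm), τ d₀ = A ∧
    List.Forall₂ BetaStar (U.map (Tm.subst τ) ++ E) (V.map (Tm.subst (fillMark A d)))

theorem isStable_argsFrom {A : Tm} (hA : A.Closed) (d₀ : ℕ) (U : List Tm) :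
    IsStable (ArgsFrom A d₀ U) where
  beta := by
    rintro d L L' ⟨τ, E, h0, h1⟩ hL
    refine ⟨τ, E, h0, forall₂_comp (R := BetaStar) (S := BetaStar)
      (fun _ _ _ h h' => BetaStar.trans h h') h1 ?_⟩
    rw [List.forall₂_map_left_iff, List.forall₂_map_right_iff]
    exact hL.imp fun _ _ h => h.subst _
  append := by
    rintro d L L' ⟨τ, E, h0, h1⟩
    refine ⟨τ, E ++ L'.map (Tm.subst (fillMark A d)), h0, ?_⟩
    rw [← List.append_assoc, List.map_append]
    exact List.rel_append h1 (List.forall₂_same.2 fun _ _ => BetaStar.refl _)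
  subst := by
    rintro e d L s ⟨τ, E, h0, h1⟩ hs0 hs1
    set s' : ℕ → Tm := fun i => (s i).subst (fillMark A d) with hs'
    refine ⟨fun i => (τ i).subst s', E.map (Tm.subst s'), by simp [h0, hA.subst], ?_⟩
    have e1 : ∀ t : Tm, (t.subst s).subst (fillMark A d) = (t.subst (fillMark A e)).subst s' := by
      intro t
      rw [subst_subst, subst_subst]
      congr 1
      funext i
      by_cases hi : i = e
      · subst hi
        simp [hs0, fillMark, Tm.subst, hA.subst]
      · by_cases hi' : i = e + 1
        · subst hi'
          simp [hs1, fillMark, Tm.subst, hA.subst]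
        · simp [fillMark, hi, hi', Tm.subst, hs']
    have h2 : List.Forall₂ BetaStar ((U.map (Tm.subst τ) ++ E).map (Tm.subst s'))
        ((L.map (Tm.subst (fillMark A e))).map (Tm.subst s')) := by
      rw [List.forall₂_map_left_iff, List.forall₂_map_right_iff]
      exact h1.imp fun _ _ h => h.subst _
    simp only [List.map_append, List.map_map, Function.comp_def, ← e1] at h2 ⊢
    have e2 : ∀ t : Tm, (t.subst τ).subst s' = t.subst fun i => (τ i).subst s' :=
      fun t => subst_subst t τ s'
    simp only [e2] at h2
    exact h2

section

variable {F A : Tm} {Fs : ℕ → Tm} {C : ℕ → Ctx}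

theorem IsCofinal.freeBelow (hF : (Tm.lam F).Closed) (hFs : IsCofinal F Fs) (k : ℕ) :
    (Fs k).FreeBelow 1 := by
  induction k with
  | zero => rw [hFs.zero]; exact hF
  | succ k ih => exact (hFs.step k).freeBelow ih

theorem IsGoodBranch.args_freeBelow (hF : (Tm.lam F).Closed) (hFs : IsCofinal F Fs)
    (hC : IsGoodBranch A Fs C) (k : ℕ) : ∀ u ∈ Ctx.args (C k), u.FreeBelow (Ctx.depth (C k) + 1) :=
  (fill_freeBelow (C k) (by rw [← hC.occ k]; exact hFs.freeBelow hF k)).2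

theorem argsAt_eq {V : Ctx} (hV : ∀ u ∈ Ctx.args V, u.FreeBelow (Ctx.depth V + 1)) (A : Tm) :
    (Ctx.args V).map (Tm.subst (fillMark A (Ctx.depth V))) = Ctx.argsAt V A := by
  refine List.map_congr_left fun u hu => ?_
  refine subst_congr_of_freeBelow (hV u hu) fun i hi => ?_
  have : i ≠ Ctx.depth V + 1 := by omega
  simp [fillMark, this]

/-- The arguments of the occurrence at a later level of the branch come from those at an earlier
level by substitution and reduction, up to further arguments. -/
theorem IsGoodBranch.args_later (hF : (Tm.lam F).Closed) (hA : A.Closed) (hFs : IsCofinal F Fs)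
    (hC : IsGoodBranch A Fs C) {k j : ℕ} (hkj : k ≤ j) :
    ∃ (τ : ℕ → Tm) (E : List Tm), τ (Ctx.depth (C k)) = A ∧
      List.Forall₂ BetaStar ((Ctx.args (C k)).map (Tm.subst τ) ++ E) (Ctx.argsAt (C j) A) := by
  have key : ArgsFrom A (Ctx.depth (C k)) (Ctx.args (C k)) (Ctx.depth (C j)) (Ctx.args (C j)) := by
    induction j, hkj using Nat.le_induction with
    | base =>
      refine ⟨fillMark A (Ctx.depth (C k)), [], by simp [fillMark], ?_⟩
      rw [List.append_nil]
      exact List.forall₂_same.2 fun _ _ => BetaStar.refl _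
    | succ j _ ih =>
      obtain ⟨C'', hb, hC''⟩ := hC.residue j
      have h1 := hFs.freeBelow hF j
      rw [hC.occ j] at h1
      -- Only the chosen occurrence is marked, and marks keep the property along the reduction.
      have h2 := ((AllOcc.fill (C j) (t := var (Ctx.depth (C j) + 1)) h1 fun _ => ih).betaStar
        (isStable_argsFrom hA _ _) hb).of_fill C'' rfl
      rw [← hC'', depth_rename, args_rename]
      obtain ⟨τ, E, h3, h4⟩ := h2
      refine ⟨τ, E, h3, ?_⟩
      rw [List.map_map]
      have e : Tm.subst (fillMark A (Ctx.depth C'')) ∘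
          Tm.rename (liftRenN (Ctx.depth C'') unmark) =
          Tm.subst (fillMark A (Ctx.depth C'')) := by
        funext t
        simp only [Function.comp_apply, subst_rename, fillMark_unmark]
      rwa [e]
  obtain ⟨τ, E, h0, h1⟩ := key
  rw [argsAt_eq (hC.args_freeBelow hF hFs j)] at h1
  exact ⟨τ, E, h0, h1⟩

theorem exists_args_prefix (C : Ctx) (t : Tm) :
    ∃ C₁ C₂, C = C₁ ++ C₂ ∧ Ctx.fill C₁ t = apps t (Ctx.args C) ∧ Ctx.depth C₂ = Ctx.depth C := by
  induction C generalizing t with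
  | nil => exact ⟨[], [], rfl, rfl, rfl⟩
  | cons f C ih =>
    cases f with
    | lam => exact ⟨[], _, rfl, rfl, rfl⟩
    | arg u => exact ⟨[], _, rfl, rfl, rfl⟩
    | fn u =>
      obtain ⟨C₁, C₂, rfl, h1, h2⟩ := ih (app t u)
      exact ⟨Frame.fn u :: C₁, C₂, rfl, h1, h2⟩

theorem apps_var_replace (d : ℕ) (L : List Tm) (B : Tm) :
    (apps (var d) L).replace d B = apps B (L.map fun u => u.replace d B) := by
  unfold Tm.replace
  rw [apps_subst]
  simp [Tm.subst]

theorem Good.solvable {V : Ctx} (hV : Good A V) : Solvable (apps A (Ctx.argsAt V A)) := by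
  obtain ⟨C₁, C₂, h0, h1, h2⟩ := exists_args_prefix V (var (Ctx.depth V))
  have := hV.2 C₁ C₂ h0
  rw [h1, h2, apps_var_replace] at this
  exact this

end

/-! ### Comparison with the finite approximations -/

/-- The finite approximation for the values `h i, …, h (i + c - 1)`, in which `g` stands for all
that comes later. -/
def tower (h : ℕ → ℕ) : ℕ → ℕ → Tm → Tm
  | _, 0, g => g
  | i, c + 1, g => expand (h i) (tower h (i + 1) c g)

theorem tower_succ' (h : ℕ → ℕ) (i c : ℕ) (g : Tm) :
    tower h i (c + 1) g = tower h i c (expand (h (i + c)) g) := by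
  induction c generalizing i with
  | zero => rfl
  | succ c ih =>
    show expand (h i) (tower h (i + 1) (c + 1) g) = expand (h i) _
    rw [ih, Nat.add_right_comm i 1 c]
    rfl

theorem approxJ_eq_tower (h : ℕ → ℕ) (N : ℕ) (g : Tm) : approxJ h N g = tower h 0 (N + 1) g := by
  induction N generalizing g with
  | zero => rfl
  | succ N ih =>
    rw [tower_succ', Nat.zero_add, ← ih]
    rfl

theorem tower_subst (h : ℕ → ℕ) (i c : ℕ) (g : Tm) (s : ℕ → Tm) :
    (tower h i c g).subst s = tower h i c (g.subst s) := by
  induction c generalizing i with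
  | zero => rfl
  | succ c ih =>
    show (expand (h i) _).subst s = _
    rw [expand_subst, ih]
    rfl

theorem tower_rename (h : ℕ → ℕ) (i c g : ℕ) (r : ℕ → ℕ) :
    (tower h i c (var g)).rename r = tower h i c (var (r g)) := by
  rw [rename_eq_subst, tower_subst]
  rfl

/-- Three lists of the same length with related entries. -/
inductive Forall₃ {α β γ : Type*} (R : α → β → γ → Prop) : List α → List β → List γ → Prop
  | nil : Forall₃ R [] [] []
  | cons {a b c L M N} : R a b c → Forall₃ R L M N → Forall₃ R (a :: L) (b :: M) (c :: N)

namespace Forall₃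

variable {α β γ α' β' γ' : Type*} {R : α → β → γ → Prop} {S : α' → β' → γ' → Prop}
  {L L' : List α} {M M' : List β} {N N' : List γ}

theorem length_eq (h : Forall₃ R L M N) : M.length = L.length ∧ N.length = L.length := by
  induction h with
  | nil => simp
  | cons _ _ ih => simpa using ih

theorem append (h : Forall₃ R L M N) (h' : Forall₃ R L' M' N') :
    Forall₃ R (L ++ L') (M ++ M') (N ++ N') := by
  induction h with
  | nil => exact h'
  | cons h1 _ ih => exact cons h1 ih

theorem map {f : α → α'} {g : β → β'} {k : γ → γ'} (hRS : ∀ a b c, R a b c → S (f a) (g b) (k c))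
    (h : Forall₃ R L M N) : Forall₃ S (L.map f) (M.map g) (N.map k) := by
  induction h with
  | nil => exact nil
  | cons h1 _ ih => exact cons (hRS _ _ _ h1) ih

theorem take_drop (h : Forall₃ R L M N) (e : ℕ) :
    Forall₃ R (L.take e) (M.take e) (N.take e) ∧ Forall₃ R (L.drop e) (M.drop e) (N.drop e) := by
  induction h generalizing e with
  | nil => simpa using nil
  | cons h1 h2 ih =>
    cases e with
    | zero => exact ⟨nil, cons h1 h2⟩
    | succ e => exact ⟨cons h1 (ih e).1, (ih e).2⟩

theorem comp_right {T : γ → γ' → Prop} {S : α → β' → γ' → Prop} {g : β → β'} {N' : List γ'}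
    (hRS : ∀ a b c c', R a b c → T c c' → S a (g b) c') (h : Forall₃ R L M N)
    (h' : List.Forall₂ T N N') : Forall₃ S L (M.map g) N' := by
  induction h generalizing N' with
  | nil => cases h'; exact nil
  | cons h1 _ ih =>
    cases h' with
    | cons h2 h3 => exact cons (hRS _ _ _ _ h1 h2) (ih h3)

theorem forall₂ {T : α → γ → Prop} (hRT : ∀ a b c, R a b c → T a c) (h : Forall₃ R L M N) :
    List.Forall₂ T L N := by
  induction h with
  | nil => exact .nil
  | cons h1 _ ih => exact .cons (hRT _ _ _ h1) ih

theorem diag {R : α → α → α → Prop} {L : List α} (h : ∀ a ∈ L, R a a a) : Forall₃ R L L L := by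
  induction L with
  | nil => exact nil
  | cons a L ih => exact cons (h a (by simp)) (ih fun b hb => h b (by simp [hb]))

end Forall₃

/-- `Sim h G κ n N g m₀ m₁ m₂`: the term `m₂` arises from `m₀` by putting in wrappers for `cₙ`. In
the term `m₁` some of the wrappers of index at most `N + 1` are represented by the finite
approximation with the constant `var g` in the place of the wrappers of index `N + 1`, and the
others are left out. The approximations take any term `X` in the place of the numeral. -/
inductive Sim (h : ℕ → ℕ) (G : Tm) (κ : ℕ → List Tm) (n N : ℕ) : ℕ → Tm → Tm → Tm → Prop
  | var {g i : ℕ} : i ≠ g → Sim h G κ n N g (var i) (var i) (var i)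
  | app {g : ℕ} {p₀ p₁ p₂ q₀ q₁ q₂ : Tm} : Sim h G κ n N g p₀ p₁ p₂ → Sim h G κ n N g q₀ q₁ q₂ →
      Sim h G κ n N g (app p₀ q₀) (app p₁ q₁) (app p₂ q₂)
  | lam {g : ℕ} {p₀ p₁ p₂ : Tm} : Sim h G κ n N (g + 1) p₀ p₁ p₂ →
      Sim h G κ n N g (lam p₀) (lam p₁) (lam p₂)
  | wrap {g : ℕ} {K m₀ m₁ m₂ : Tm} : AnyNear G κ n K → Sim h G κ n N g m₀ m₁ m₂ →
      Sim h G κ n N g m₀ m₁ (app K m₂)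
  | tower {g i c : ℕ} {K X m₀ m₁ m₂ : Tm} : Near G κ n i K → i + c = N + 1 →
      Sim h G κ n N g m₀ m₁ m₂ →
      Sim h G κ n N g m₀ (app (app (tower h i c (var g)) X) m₁) (app K m₂)

/-- `Hits g b k t`: in `k` steps of weak head reduction `t` comes to a term that consists of the
variable `g` with `b` arguments. -/
inductive Hits (g b : ℕ) : ℕ → Tm → Prop
  | done {L : List Tm} : L.length = b → Hits g b 0 (apps (var g) L)
  | step {k : ℕ} {t u : Tm} : WH t u → Hits g b k u → Hits g b (k + 1) t

theorem apps_var_inj {y z : ℕ} {L M : List Tm} (h : apps (var y) L = apps (var z) M) :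
    y = z ∧ L.length = M.length := by
  induction L using List.reverseRecOn generalizing M with
  | nil =>
    rcases List.eq_nil_or_concat M with rfl | ⟨M, v, rfl⟩
    · exact ⟨Tm.var.inj h, rfl⟩
    · rw [List.concat_eq_append, apps_concat] at h
      cases h
  | append_singleton L u ih =>
    rcases List.eq_nil_or_concat M with rfl | ⟨M, v, rfl⟩
    · rw [apps_concat] at h
      cases h
    · rw [List.concat_eq_append, apps_concat, apps_concat] at h
      obtain ⟨h1, h2⟩ := ih (Tm.app.inj h).1
      exact ⟨h1, by simp [h2]⟩

theorem Hits.rename {g b k : ℕ} {t : Tm} (h : Hits g b k t) (r : ℕ → ℕ) :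
    Hits (r g) b k (t.rename r) := by
  induction h with
  | done hL =>
    rw [apps_rename]
    exact Hits.done (by simpa using hL)
  | step hw _ ih => exact Hits.step (hw.rename r) ih

theorem Hits.of_apps_var {g b k y : ℕ} {L : List Tm} (h : Hits g b k (RangeH.apps (Tm.var y) L)) :
    y = g ∧ L.length = b := by
  generalize ht : RangeH.apps (Tm.var y) L = t at h
  cases h with
  | done hL =>
    obtain ⟨h1, h2⟩ := apps_var_inj ht
    exact ⟨h1, h2.trans hL⟩
  | step hw _ =>
    subst ht
    exact absurd hw (Neutral.not_wh (neutral_apps.2 trivial))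

theorem Hits.not_lam {g b k : ℕ} {p : Tm} : ¬ Hits g b k (Tm.lam p) := by
  intro h
  generalize ht : Tm.lam p = t at h
  cases h with
  | @done L _ =>
    have : Neutral (Tm.lam p) := ht ▸ neutral_apps.2 trivial
    exact this
  | step hw _ => subst ht; cases hw

theorem Hits.of_wh {g b k : ℕ} {t u : Tm} (h : Hits g b k t) (hw : WH t u) :
    ∃ k', k = k' + 1 ∧ Hits g b k' u := by
  cases h with
  | done => exact absurd hw (Neutral.not_wh (neutral_apps.2 trivial))
  | step hw' h => exact ⟨_, rfl, hw.det hw' ▸ h⟩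

theorem Hits.of_whs {g b k : ℕ} {t u : Tm} (h : Hits g b k t) (hw : WHs t u) :
    ∃ k' ≤ k, Hits g b k' u := by
  induction hw with
  | refl => exact ⟨k, le_rfl, h⟩
  | tail _ hw ih =>
    obtain ⟨k', hk, h'⟩ := ih
    obtain ⟨k'', rfl, h''⟩ := h'.of_wh hw
    exact ⟨k'', by omega, h''⟩

theorem exists_hits {g : ℕ} {t : Tm} {L : List Tm} (h : WHs t (apps (var g) L)) :
    ∃ k, Hits g L.length k t := by
  induction h using Relation.ReflTransGen.head_induction_on with
  | refl => exact ⟨0, Hits.done rfl⟩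
  | head hw _ ih => exact ih.imp' Nat.succ fun _ h => Hits.step hw h

section

variable {h : ℕ → ℕ} {G : Tm} {κ : ℕ → List Tm} {n N g : ℕ}

theorem Sim.rename (hJ : IsExpander h G κ) {m₀ m₁ m₂ : Tm} (hm : Sim h G κ n N g m₀ m₁ m₂)
    {r : ℕ → ℕ} (hr : ∀ i ≠ g, r i ≠ r g) :
    Sim h G κ n N (r g) (m₀.rename r) (m₁.rename r) (m₂.rename r) := by
  induction hm generalizing r with
  | var hi => exact Sim.var (hr _ hi)
  | app _ _ hp hq => exact Sim.app (hp hr) (hq hr)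
  | lam _ hp =>
    refine Sim.lam (hp (r := liftRen r) fun i hi => ?_)
    cases i with
    | zero => simp [liftRen]
    | succ i => simpa [liftRen] using hr i (by omega)
  | wrap hK _ hm =>
    refine Sim.wrap ?_ (hm hr)
    rwa [(AnyNear.closed hJ _ hK).rename]
  | tower hK hic _ hm =>
    simp only [Tm.rename, tower_rename, (hK.closed hJ).rename]
    exact Sim.tower hK hic (hm hr)

theorem Sim.rename_succ (hJ : IsExpander h G κ) {m₀ m₁ m₂ : Tm}
    (hm : Sim h G κ n N g m₀ m₁ m₂) :
    Sim h G κ n N (g + 1) (m₀.rename Nat.succ) (m₁.rename Nat.succ) (m₂.rename Nat.succ) :=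
  hm.rename hJ fun _ hi => fun he => hi (Nat.succ.inj he)

theorem Sim.subst (hJ : IsExpander h G κ) {m₀ m₁ m₂ : Tm} (hm : Sim h G κ n N g m₀ m₁ m₂)
    {g' : ℕ} {s₀ s₁ s₂ : ℕ → Tm} (hg : s₁ g = Tm.var g')
    (hs : ∀ i ≠ g, Sim h G κ n N g' (s₀ i) (s₁ i) (s₂ i)) :
    Sim h G κ n N g' (m₀.subst s₀) (m₁.subst s₁) (m₂.subst s₂) := by
  induction hm generalizing g' s₀ s₁ s₂ with
  | var hi => exact hs _ hi
  | app _ _ hp hq => exact Sim.app (hp hg hs) (hq hg hs)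
  | lam _ hp =>
    refine Sim.lam (hp (by simp [liftSub, hg, Tm.rename]) fun i hi => ?_)
    cases i with
    | zero => exact Sim.var (by omega)
    | succ i => exact (hs i (by omega)).rename_succ hJ
  | wrap hK _ hm =>
    refine Sim.wrap ?_ (hm hg hs)
    rwa [(AnyNear.closed hJ _ hK).subst]
  | tower hK hic _ hm =>
    simp only [Tm.subst, tower_subst, (hK.closed hJ).subst, hg]
    exact Sim.tower hK hic (hm hg hs)

theorem Sim.contract (hJ : IsExpander h G κ) {p₀ p₁ p₂ q₀ q₁ q₂ : Tm}
    (hp : Sim h G κ n N (g + 1) p₀ p₁ p₂) (hq : Sim h G κ n N g q₀ q₁ q₂) :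
    Sim h G κ n N g (p₀.contract q₀) (p₁.contract q₁) (p₂.contract q₂) := by
  rw [contract_eq, contract_eq, contract_eq]
  refine hp.subst hJ rfl fun i hi => ?_
  cases i with
  | zero => exact hq
  | succ i => exact Sim.var (by omega)

/-- Substitution of related terms for the variables of a term. -/
theorem sim_subst (hJ : IsExpander h G κ) {t : Tm} {d : ℕ} (ht : t.FreeBelow d)
    {s₀ s₁ s₂ : ℕ → Tm} (hs : ∀ i < d, Sim h G κ n N g (s₀ i) (s₁ i) (s₂ i)) :
    Sim h G κ n N g (t.subst s₀) (t.subst s₁) (t.subst s₂) := by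
  induction t generalizing d g s₀ s₁ s₂ with
  | var i => exact hs i ht
  | app u v hu hv => exact Sim.app (hu ht.1 hs) (hv ht.2 hs)
  | lam t ih =>
    refine Sim.lam (ih (d := d + 1) ht fun i hi => ?_)
    cases i with
    | zero => exact Sim.var (by omega)
    | succ i => exact (hs i (by omega)).rename_succ hJ

theorem sim_refl (hJ : IsExpander h G κ) {t : Tm} (ht : t.FreeBelow g) :
    Sim h G κ n N g t t t := by
  have := sim_subst (n := n) (N := N) hJ ht (s₀ := Tm.var) (s₁ := Tm.var) (s₂ := Tm.var)
    fun i hi => Sim.var (Nat.ne_of_lt hi)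
  rwa [subst_var] at this

theorem Sim.ex {m₀ m₁ m₂ : Tm} (hm : Sim h G κ n N g m₀ m₁ m₂) :
    Ex (AnyNear G κ n) m₀ m₂ := by
  induction hm with
  | var => exact Ex.var _
  | app _ _ hp hq => exact Ex.app hp hq
  | lam _ hp => exact Ex.lam hp
  | wrap hK _ hm => exact Ex.wrap hK hm
  | tower hK _ _ hm => exact Ex.wrap ⟨_, hK⟩ hm

theorem Sim.wrapOpt {i : ℕ} {m₀ m₁ t t' : Tm} (hm : Sim h G κ n N g m₀ m₁ t)
    (hw : WrapOpt G κ n i t t') : Sim h G κ n N g m₀ m₁ t' := by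
  rcases hw with rfl | ⟨K', hK', rfl⟩
  · exact hm
  · exact Sim.wrap ⟨_, hK'.near⟩ hm

/-- An approximation with too few arguments reduces to an abstraction. -/
theorem whs_expand_lam {e : ℕ} (T n u : Tm) {Z : List Tm} (hZ : Z.length < e) :
    ∃ p, WHs (apps (app (app (expand e T) n) u) Z) (lam p) := by
  obtain ⟨p, hp⟩ := whs_lams_apps_lam Z hZ (apps (u.rename (· + e))
      ((List.range e).map fun i =>
        app (app (T.rename (· + e)) (n.rename (· + e))) (var (e - 1 - i)))) var
  rw [subst_var] at hp
  exact ⟨p, (WHs.apps (whs_expand e T n u) Z).trans hp⟩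

/-- If the head reduction of the term with the approximations brings the constant into head
position, then in the term with the wrappers a wrapper of index `N + 1` comes into head position, in
front of a term and of arguments that it exceeds in arity. The nests that it makes up survive. -/
theorem Sim.lastNest (hJ : IsExpander h G κ) {b l k : ℕ} {m₀ m₁ m₂ : Tm} {Z₀ Z₁ Z₂ Y : List Tm}
    (hm : Sim h G κ n N g m₀ m₁ m₂) (hZ : Forall₃ (Sim h G κ n N g) Z₀ Z₁ Z₂)
    (hY : ∀ y ∈ Y, Nest G κ n y) (hk : Hits g (b + 2) k (RangeH.apps m₁ Z₁))
    (hn : Hn l (RangeH.apps m₀ Z₀)) (hl : b + l + 1 ≤ h (N + 1)) :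
    LastNest G κ n (RangeH.apps m₂ (Z₂ ++ Y)) := by
  induction k using Nat.strong_induction_on generalizing g m₀ m₁ m₂ Z₀ Z₁ Z₂ Y with
  | _ k IH =>
    -- The inner induction is on the derivation of `Sim`. As variables are shifted when a wrapper
    -- without counterpart is supplied with fresh ones, the terms are considered up to a renaming
    -- that keeps the constant apart from the other variables.
    have key : ∀ {g : ℕ} {m₀ m₁ m₂ : Tm}, Sim h G κ n N g m₀ m₁ m₂ →
        ∀ (ρ : ℕ → ℕ) (k' : ℕ) (Z₀ Z₁ Z₂ Y : List Tm), (∀ i ≠ g, ρ i ≠ ρ g) → k' ≤ k →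
        Forall₃ (Sim h G κ n N (ρ g)) Z₀ Z₁ Z₂ → (∀ y ∈ Y, Nest G κ n y) →
        Hits (ρ g) (b + 2) k' (RangeH.apps (m₁.rename ρ) Z₁) →
        Hn l (RangeH.apps (m₀.rename ρ) Z₀) →
        LastNest G κ n (RangeH.apps (m₂.rename ρ) (Z₂ ++ Y)) := by
      intro g m₀ m₁ m₂ hm
      induction hm with
      | @var g i hi =>
        intro ρ k' Z₀ Z₁ Z₂ Y hρ _ _ _ hk _
        exact absurd (Hits.of_apps_var hk).1 (hρ i hi)
      | app _ hq ihp _ =>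
        intro ρ k' Z₀ Z₁ Z₂ Y hρ hk' hZ hY hk hn
        exact ihp ρ k' _ _ _ Y hρ hk' (.cons (hq.rename hJ hρ) hZ) hY hk hn
      | @lam g p₀ p₁ p₂ hp _ =>
        intro ρ k' Z₀ Z₁ Z₂ Y hρ hk' hZ hY hk hn
        cases hZ with
        | nil => exact absurd hk Hits.not_lam
        | @cons z₀ z₁ z₂ Z₀ Z₁ Z₂ hz hZ =>
          obtain ⟨k'', rfl, hk''⟩ := hk.of_wh (WH.apps (WH.red _ z₁) Z₁)
          refine LastNest.wh (WH.apps (WH.red _ z₂) (Z₂ ++ Y)) ?_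
          refine IH k'' (by omega) (Sim.contract hJ (hp.rename (r := liftRen ρ) hJ ?_) hz) hZ hY
            hk'' (hn.of_wh (WH.apps (WH.red _ z₀) Z₀))
          intro i hi
          cases i with
          | zero => simp [liftRen]
          | succ i => simpa [liftRen] using hρ i (by omega)
      | @wrap g K m₀ m₁ m₂ hK hm ih =>
        intro ρ k' Z₀ Z₁ Z₂ Y hρ hk' hZ hY hk hn
        obtain ⟨i, hK⟩ := hK
        show LastNest G κ n (RangeH.apps (Tm.app (K.rename ρ) (m₂.rename ρ)) (Z₂ ++ Y))
        rw [(hK.closed hJ).rename]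
        obtain ⟨e, Z', E, hZ', hE, -, H⟩ := hK.unfold_any hJ (m₂.rename ρ) (Z₂ ++ Y)
        refine H ?_
        rw [List.map_append] at hZ'
        obtain ⟨Z₃, Y', rfl, hZ₃, hY'⟩ := forall₂_append_left hZ'
        rw [List.append_assoc, rename_rename]
        refine ih (fun i => ρ i + e) k' (Z₀.map (Tm.rename (· + e))) (Z₁.map (Tm.rename (· + e)))
          _ _ (fun i hi he => hρ i hi (by simpa using he)) hk' ?_ ?_ ?_ ?_
        · have h1 := hZ.map (S := Sim h G κ n N (ρ g + e)) (f := Tm.rename (· + e))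
            (g := Tm.rename (· + e)) (k := Tm.rename (· + e))
            fun _ _ _ h => h.rename (r := (· + e)) hJ fun i hi he => hi (by simpa using he)
          have h2 := h1.comp_right (g := id) (S := Sim h G κ n N (ρ g + e))
            (fun _ _ _ _ h3 h4 => h3.wrapOpt h4) hZ₃
          rwa [List.map_id] at h2
        · intro y hy
          rcases List.mem_append.1 hy with hy | hy
          · obtain ⟨z, hz, hzy⟩ := exists_of_forall₂_right hY' hy
            obtain ⟨x, hx, rfl⟩ := List.mem_map.1 hz
            exact ((hY x hx).rename hJ _).wrapOpt hzy
          · exact hE y hy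
        · have := hk.rename (· + e)
          rwa [apps_rename, rename_rename] at this
        · have := hn.rename (· + e)
          rwa [apps_rename, rename_rename] at this
      | @tower g i c K X m₀ m₁ m₂ hK hic hm ih =>
        intro ρ k' Z₀ Z₁ Z₂ Y hρ hk' hZ hY hk hn
        show LastNest G κ n (RangeH.apps (Tm.app (K.rename ρ) (m₂.rename ρ)) (Z₂ ++ Y))
        simp only [Tm.rename, tower_rename] at hk
        rw [(hK.closed hJ).rename]
        have hlen := hZ.length_eq
        cases c with
        | zero =>
          -- the constant is in head position: `X`, `m₁` and `Z₁` are its `b + 2` arguments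
          have h1 := (Hits.of_apps_var (L := X.rename ρ :: m₁.rename ρ :: Z₁) hk).2
          obtain rfl : i = N + 1 := hic
          refine hK.lastNest hJ hn (hm.rename hJ hρ).ex (hZ.forall₂ fun _ _ _ h => h.ex) hY ?_
          simp only [List.length_cons] at h1
          omega
        | succ c =>
          rcases lt_or_ge Z₁.length (h i) with hlt | hle
          · obtain ⟨p, hp⟩ := whs_expand_lam (RangeH.tower h (i + 1) c (Tm.var (ρ g)))
              (X.rename ρ) (m₁.rename ρ) hlt
            obtain ⟨_, _, h1⟩ := Hits.of_whs hk hp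
            exact absurd h1 Hits.not_lam
          · -- Both sides unfold. The run need not get shorter, but the derivation does.
            have h1 := WHs.apps (whs_expand_apps (h := h i)
              (RangeH.tower h (i + 1) c (Tm.var (ρ g))) (X.rename ρ) (m₁.rename ρ)
              (Z := Z₁.take (h i)) (by simp [hle])) (Z₁.drop (h i))
            rw [← apps_append, ← apps_append, List.take_append_drop] at h1
            obtain ⟨k'', hk'', h2⟩ := Hits.of_whs hk h1
            obtain ⟨Z', hZ', H⟩ := hK.unfold hJ (m₂.rename ρ) (Z := Z₂.take (h i))
              (by simp; omega)
            obtain ⟨hZ1, hZ2⟩ := hZ.take_drop (h i)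
            have h3 := (hZ1.comp_right
                (g := Tm.app (Tm.app (RangeH.tower h (i + 1) c (Tm.var (ρ g))) (X.rename ρ)))
                (S := Sim h G κ n N (ρ g))
                (T := fun z z' => ∃ K', Exact G κ n (i + 1) K' ∧ z' = Tm.app K' z)
                (fun _ _ _ _ h4 h5 => by
              obtain ⟨K', hK', rfl⟩ := h5
              exact Sim.tower (X := X.rename ρ) (c := c) hK'.near (by omega) h4) hZ').append hZ2
            rw [List.take_append_drop] at h3
            obtain ⟨v, hv, hnest⟩ := ih ρ k'' _ _ _ Y hρ (by omega) h3 hY h2 hn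
            refine ⟨v, ?_, hnest⟩
            rw [← List.take_append_drop (h i) Z₂, List.append_assoc]
            rw [List.append_assoc] at hv
            exact H _ _ hv
    have := key hm (fun i => i) k Z₀ Z₁ Z₂ Y (fun _ hi => hi) le_rfl hZ hY
      (by rwa [rename_id]) (by rwa [rename_id])
    rwa [rename_id] at this

end

/-! ### The range is infinite -/

theorem EqH.refl (t : Tm) : EqH t t := ⟨t, .refl, .refl⟩

theorem hn_apps_of_forall₂_betaStar {t : Tm} {L L' : List Tm} {l : ℕ}
    (hL : List.Forall₂ BetaStar L L') (h : HasHnf (apps t L') l) : Hn l (apps t L) := by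
  obtain ⟨y, w, h⟩ := h
  exact HasHnf.hn ⟨y, w, ((BetaStar.refl t).apps hL).trans h⟩

section

variable {F A : Tm} {Fs : ℕ → Tm} {C : ℕ → Ctx} {h : ℕ → ℕ} {G : Tm} {κ : ℕ → List Tm}

/-- It is enough to find, for each level `k` of the branch, a substitution and further arguments
that turn `(x Uₖ)[Aₙ]` into a term whose head normal form has a nest of wrappers for `cₙ` as its
last argument, for each `n`. -/
theorem range_infinite_of_lastNest (hJ : IsExpander h G κ) {An : ℕ → Tm}
    (hclosed : ∀ n, (An n).Closed)
    (hscope : ∀ n m, EqH (F.replace 0 (An n)) (F.replace 0 (An m)) →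
      ∃ k, EqH
        ((apps (var (Ctx.depth (C k))) (Ctx.args (C k))).replace (Ctx.depth (C k)) (An n))
        ((apps (var (Ctx.depth (C k))) (Ctx.args (C k))).replace (Ctx.depth (C k)) (An m)))
    (hlast : ∀ k, ∃ (τ : ℕ → Tm) (E : List Tm), ∀ n, LastNest G κ n (apps (An n)
      ((Ctx.args (C k)).map (Tm.subst fun i => if i = Ctx.depth (C k) then An n else τ i) ++ E))) :
    (rangeH F).Infinite := by
  refine Set.infinite_of_injective_forall_mem (f := fun n => classH (F.replace 0 (An n)))
    (fun n m hnm => ?_) fun n => ⟨An n, hclosed n, rfl⟩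
  have h1 : F.replace 0 (An m) ∈ classH (F.replace 0 (An m)) := EqH.refl _
  rw [← show classH (F.replace 0 (An n)) = classH (F.replace 0 (An m)) from hnm] at h1
  obtain ⟨k, hk⟩ := hscope n m h1
  obtain ⟨τ, E, hE⟩ := hlast k
  have h2 : ∀ n, apps (((apps (var (Ctx.depth (C k))) (Ctx.args (C k))).replace
      (Ctx.depth (C k)) (An n)).subst τ) E = apps (An n) ((Ctx.args (C k)).map
        (Tm.subst fun i => if i = Ctx.depth (C k) then An n else τ i) ++ E) := by
    intro n
    rw [apps_var_replace, apps_subst, (hclosed n).subst, List.map_map, apps_append]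
    congr 2
    refine List.map_congr_left fun u _ => ?_
    simp only [Function.comp_apply, Tm.replace, subst_subst]
    congr 1
    funext i
    split
    · exact (hclosed n).subst τ
    · rfl
  have h3 := (hk.subst τ).apps E
  rw [h2, h2] at h3
  exact (hE n).eq_of_eqH hJ (hE m) h3

theorem map_subst_argsAt (hA : A.Closed) (V : Ctx) {τ : ℕ → Tm} (hτ : τ (Ctx.depth V) = A) :
    (Ctx.argsAt V A).map (Tm.subst τ) = (Ctx.args V).map (Tm.subst τ) := by
  unfold Ctx.argsAt
  rw [List.map_map]
  refine List.map_congr_left fun u _ => ?_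
  simp only [Function.comp_apply, Tm.replace, subst_subst]
  congr 1
  funext i
  split_ifs with hi
  · rw [hA.subst, hi, hτ]
  · rfl

/-- The case of constant arity. The arity exceeds the length of `Uₖ` and the number of abstractions
of `(A Uₖ[A])` together, so that no further arguments are needed. -/
theorem range_infinite_of_firstConstruction (hF : (Tm.lam F).Closed) (hA : A.Closed)
    (hFs : IsCofinal F Fs) (hC : IsGoodBranch A Fs C) {A' : Tm} (hA' : FirstConstruction A C A')
    (hscope : ScopeLemma F C A') : (rangeH F).Infinite := by
  obtain ⟨l, q, p, hlen, ⟨k₀, hq⟩, hp, rfl⟩ := hA'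
  have hJ := isExpander_const (show 1 ≤ p by omega)
  set G := Tm.lam (expand p (var 0)) with hG
  have hK := fun n => exact_self G (fun _ => []) n 0
  have e : ∀ n, numeralInstance (apps (constJ p) [var 0, A]) n =
      app (app (apps turing [G]) (church n)) A := by
    intro n
    unfold numeralInstance Tm.replace
    rw [apps_subst, Tm.Closed.subst (show (constJ p).Closed from ⟨turing_closed, hJ.closed⟩)]
    simp only [List.map_cons, List.map_nil, Tm.subst, hA.subst, if_true]
    rfl
  refine range_infinite_of_lastNest hJ (C := C)
    (An := fun n => app (app (apps turing [G]) (church n)) A)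
    (fun n => ⟨(hK n).closed hJ, hA⟩) (fun n m => ?_) fun k => ⟨var, [], fun n => ?_⟩
  · rw [← e n, ← e m]
    exact hscope n m
  · obtain ⟨lk, hlk⟩ := solvable_iff.1 (Good.solvable (hC.good k))
    -- At a late level the number of abstractions is `q`. Substitution cannot remove abstractions,
    -- and the arguments `E` that come in remove at most one each, but they count for the length `l`.
    have hbound : lk + (Ctx.args (C k)).length ≤ q + l := by
      obtain ⟨τ, E, hτ, hE⟩ := hC.args_later hF hA hFs (le_max_left k k₀)
      have h1 := hn_apps_of_forall₂_betaStar hE (hq _ (le_max_right k k₀))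
      rw [← map_subst_argsAt hA (C k) hτ, apps_append, ← hA.subst τ, ← apps_subst] at h1
      have h2 : lk ≤ q + E.length := Hn.le_of_subst_apps (by rwa [hA.subst]) h1
      have h3 := hE.length_eq
      have h4 := hlen (max k k₀)
      simp only [Ctx.argsAt, List.length_append, List.length_map] at h3
      omega
    rw [List.append_nil]
    have h1 := (hK n).near.lastNest hJ (m' := A) (Y := [])
      (Q' := (Ctx.args (C k)).map fun u => u.replace (Ctx.depth (C k))
        (app (app (apps turing [G]) (church n)) A))
      hlk (Ex.refl _ A) ?_ (by simp) (by simp [Ctx.argsAt]; omega)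
    · rw [List.append_nil] at h1
      refine Eq.mp ?_ h1
      rfl
    · unfold Ctx.argsAt
      rw [List.forall₂_map_left_iff, List.forall₂_map_right_iff]
      refine List.forall₂_same.2 fun u _ => (Ex.refl _ u).subst (AnyNear.closed hJ) fun i => ?_
      split_ifs
      · exact Ex.wrap ⟨0, (hK n).near⟩ (Ex.refl _ A)
      · exact Ex.var i

theorem argsAt_freeBelow (hA : A.Closed) {V : Ctx}
    (hV : ∀ u ∈ Ctx.args V, u.FreeBelow (Ctx.depth V + 1)) :
    ∀ u ∈ Ctx.argsAt V A, u.FreeBelow (Ctx.depth V) := by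
  intro u hu
  obtain ⟨v, hv, rfl⟩ := List.mem_map.1 hu
  refine (hV v hv).subst fun i hi => ?_
  split_ifs with h
  · exact hA.freeBelow _
  · exact show i < Ctx.depth V by omega

/-- Rename the constant of an approximation and apply the term to variables, one for each
abstraction at its head. -/
theorem exists_hits_of_betaStar {N d m g : ℕ} {a : Tm} {B L M : List Tm} (hA : A.Closed)
    (hL : ∀ u ∈ L, u.FreeBelow d) (hM : List.Forall₂ BetaStar M L)
    (hb : BetaStar (apps (approxJ h N (var (d + 1))) (var d :: A :: L))
      (lams m (apps (var (d + 1 + m)) (var (d + m) :: a :: B)))) (y : ℕ) :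
    ∃ k, Hits g (B.length + 2) k (apps (app (app (tower h 0 (N + 1) (var g)) (var d)) A)
      (M ++ (List.replicate m y).map var)) := by
  set s : ℕ → Tm := fun i => if i = d + 1 then var g else var i with hs
  have h1 := hb.subst s
  have e1 : L.map (Tm.subst s) = L := by
    conv_rhs => rw [← List.map_id L]
    refine List.map_congr_left fun u hu => subst_of_freeBelow (hL u hu) fun i hi => ?_
    exact if_neg (by omega)
  have e2 : s d = var d := if_neg (by omega)
  have e3 : s (d + 1) = var g := if_pos rfl
  rw [apps_subst, approxJ_eq_tower, tower_subst, List.map_cons, List.map_cons, hA.subst, e1] at h1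
  simp only [Tm.subst, e2, e3] at h1
  set ys := (List.replicate m y).map var with hys
  have hlen : ys.length = m := by simp [hys]
  have h2 := h1.apps (List.forall₂_same.2 fun u (_ : u ∈ ys) => BetaStar.refl u)
  have h3 := whs_lams_apps ys (apps (var (d + 1 + m)) (var (d + m) :: a :: B)) s
  rw [hlen, apps_subst] at h3
  have e4 : (var (d + 1 + m)).subst (instList ys s) = var g := by
    rw [← e3, ← instList_add ys s (d + 1), hlen]
    rfl
  rw [e4] at h3
  have h4 := h2.trans (WHs.betaStar h3)
  have h5 : BetaStar (apps (app (app (tower h 0 (N + 1) (var g)) (var d)) A) (M ++ ys)) _ :=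
    BetaStar.trans (BetaStar.apps (BetaStar.refl _) (List.rel_append hM
      (List.forall₂_same.2 fun u (_ : u ∈ ys) => BetaStar.refl u)))
      (by rw [apps_append]; exact h4)
  obtain ⟨L', hL', h6⟩ := h5.st.whs_apps_var
  obtain ⟨k, hk⟩ := exists_hits h6
  refine ⟨k, ?_⟩
  rw [hL'] at hk
  simpa using hk

/-- The case of variable arity. The hypothesis on the arities concerns the level `j k`, so that
`(x Uₖ)[Aₙ]` is transformed into a term which reduces to the one at that level when the substituted
terms are `A` and not `Aₙ`. The abstractions of the given head normal form are fed with
variables. -/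
theorem range_infinite_of_secondConstruction (hF : (Tm.lam F).Closed) (hA : A.Closed)
    (hFs : IsCofinal F Fs) (hC : IsGoodBranch A Fs C) {A' : Tm} (hA' : SecondConstruction A C A')
    (hscope : ScopeLemma F C A') : (rangeH F).Infinite := by
  obtain ⟨h, j, H, hH, hrep, hj, hdata, rfl⟩ := hA'
  have hJ := isExpander_var hH hrep fun i => by
    obtain ⟨_, _, _, _, _, _, _, _, h1⟩ := hdata i
    omega
  set G := Tm.lam (Tm.lam (Tm.lam (Tm.lam (apps H
      [var 2, Tm.lam (Tm.lam (Tm.lam (app (var 2) (app (var 1) (apps (var 6) [app suc (var 5),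
        var 4, var 0]))))), ident, var 0])))) with hG
  have hK := fun n => exact_self G (fun i => [iterSuc i]) n 0
  have e : ∀ n, numeralInstance (apps (varJ H) [church 0, var 0, A]) n =
      app (app (apps turing [G, iterSuc 0]) (church n)) A := by
    intro n
    unfold numeralInstance Tm.replace
    rw [apps_subst, Tm.Closed.subst (show (varJ H).Closed from ⟨turing_closed, hJ.closed⟩)]
    simp only [List.map_cons, List.map_nil, (church_closed 0).subst, Tm.subst, hA.subst, if_true]
    rfl
  refine range_infinite_of_lastNest hJ (C := C)
    (An := fun n => app (app (apps turing [G, iterSuc 0]) (church n)) A)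
    (fun n => ⟨(hK n).closed hJ, hA⟩) (fun n m => ?_) fun k => ?_
  · rw [← e n, ← e m]
    exact hscope n m
  · obtain ⟨d', l, m, a, B, rfl, hl, hb, hlB⟩ := hdata k
    obtain ⟨τ, E, hτ, hE⟩ := hC.args_later hF hA hFs (hj.le_apply (x := k))
    set d := Ctx.depth (C k) with hd
    -- a constant that occurs neither in the substituted terms nor in the further arguments
    obtain ⟨g, hg⟩ := exists_freeBelow_list ((List.range (d + 1)).map τ ++ E)
    have hgτ : ∀ i ≤ d, (τ i).FreeBelow g := fun i hi => hg _ (by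
      simp only [List.mem_append, List.mem_map, List.mem_range]
      exact Or.inl ⟨i, by omega, rfl⟩)
    have hgE : ∀ u ∈ E, u.FreeBelow g := fun u hu => hg u (by simp [hu])
    obtain ⟨r, hr⟩ := exists_hits_of_betaStar (g := g) hA
      (argsAt_freeBelow hA (hC.args_freeBelow hF hFs (j k))) hE hb (g + 1)
    obtain ⟨l', hl', hn⟩ := (hn_apps_of_forall₂_betaStar hE hl).apps_var (List.replicate m (g + 1))
    rw [← apps_append] at hn
    refine ⟨τ, E ++ (List.replicate m (g + 1)).map var, fun n => ?_⟩
    have h1 := Sim.lastNest hJ (n := n) (N := k) (g := g) (Y := []) (Z₂ := (Ctx.args (C k)).map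
        (Tm.subst fun i => if i = d then app (app (apps turing [G, iterSuc 0]) (church n)) A
          else τ i) ++ (E ++ (List.replicate m (g + 1)).map var))
      (Sim.tower (X := var (Ctx.depth (C (j k)))) (hK n).near (Nat.zero_add _)
        (sim_refl hJ (hA.freeBelow g))) ?_ (by simp) hr hn (by omega)
    · rwa [List.append_nil] at h1
    · -- The first two substitutions agree, and they put `A` where the third one puts `Aₙ`.
      rw [List.append_assoc]
      refine Forall₃.append ?_ (Forall₃.append (Forall₃.diag fun u hu => sim_refl hJ (hgE u hu))
        (Forall₃.diag fun u hu => ?_))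
      · refine (Forall₃.diag (R := fun a b c => a = b ∧ b = c ∧ a ∈ Ctx.args (C k))
          fun u hu => ⟨rfl, rfl, hu⟩).map ?_
        rintro u _ _ ⟨rfl, rfl, hu⟩
        refine sim_subst hJ (hC.args_freeBelow hF hFs k u hu) fun i hi => ?_
        split_ifs with hid
        · rw [hid, hτ]
          exact Sim.wrap ⟨0, (hK n).near⟩ (sim_refl hJ (hA.freeBelow g))
        · exact sim_refl hJ (hgτ i (by omega))
      · obtain ⟨i, hi, rfl⟩ := List.mem_map.1 hu
        rw [List.eq_of_mem_replicate hi]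
        exact Sim.var (by omega)

end

end RangeH

theorem proposition6p2
    (F A : RangeH.Tm)
    (hF : (RangeH.Tm.lam F).Closed) (hA : A.Closed)
    (hFA : ¬ RangeH.EqH (F.replace 0 A) (F.replace 0 RangeH.omega))
    (Fs : ℕ → RangeH.Tm) (hFs : RangeH.IsCofinal F Fs)
    (C : ℕ → RangeH.Ctx) (hC : RangeH.IsGoodBranch A Fs C)
    (A' : RangeH.Tm)
    (hA' : RangeH.FirstConstruction A C A' ∨ RangeH.SecondConstruction A C A')
    (hscope : RangeH.ScopeLemma F C A') :
    (RangeH.rangeH F).Infinite := by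
  rcases hA' with hA' | hA'
  · exact RangeH.range_infinite_of_firstConstruction hF hA hFs hC hA' hscope
  · exact RangeH.range_infinite_of_secondConstruction hF hA hFs hC hA' hscope
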